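/- **Conventions.** A finite metric space $(X,d)$ with $|X|=n$ has rational distances, represented in binary as natural numbers over a common denominator; together with $k$ (in unary) this is an instance, and $|(X,d,k)|$ denotes the size of its representation. Throughout $1\le k\le n$. Algorithms are randomized and use a string of uniformly random bits whose length is a polynomial in the stated size parameter. **$k$-server.** Let $d\le 1$ on $X$. A configuration is $C\in X^k$; $d(C,C')$ is the minimum weight of a perfect matching between the $k$ locations of $C$ and the $k$ locations of $C'$. A request at $x\in X$ costs a configuration $C$ the loss $\ell_x(C)=0$ if $x\in C$ and $\ell_x(C)=2\min_{y\in C}d(y,x)$ otherwise. An online algorithm is given the instance and the time horizon $T\geq 1$; in round $t$ it is shown the request $x_t$ and chooses a configuration $C_t$ depending only on the instance, $T$, $x_1,\dots,x_t$ and its random bits. It is *efficient* if in each round $C_t$ is computed in time polynomial in $T$ and $|(X,d,k)|$. It has *regret* at most $R(n,T)$ if for every such instance, every $T\ge 1$ and every request sequence $x_1,\dots,x_T$ fixed in advance, $$\mathbb E\Big[\sum_{t=1}^T \ell_{x_t}(C_t)+\sum_{t=2}^T d(C_t,C_{t-1})\Big]\;\le\;\min_{C\in X^k}\sum_{t=1}^T\ell_{x_t}(C)+R(n,T).$$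 **$k$-median.** Given an instance $(X,d,k)$ (no bound on $d$), find $A\subseteq X$ with $|A|=k$ minimizing $\mathrm{VAL}(A)=\sum_{x\in X}\min_{a\in A}d(x,a)$; let $\mathrm{OPT}$ be the minimum. A polynomial-time $\rho$-approximation is a randomized algorithm that runs in time polynomial in $|(X,d,k)|$ and always outputs a set $A\subseteq X$ with $|A|=k$, such that $\mathbb E[\mathrm{VAL}(A)]\le\rho\cdot\mathrm{OPT}$ on every instance. **Theorem.** Suppose that for some $\mu>0$ and some polynomial $f$ there is an efficient online algorithm for the $k$-server problem with regret at most $f(n)\,T^{1-\mu}$. Then for every $\varepsilon>0$ there is a polynomial-time $(2+\varepsilon)$-approximation algorithm for the $k$-median problem. -/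

import Mathlib

noncomputable section

namespace KServer

/-! ### The machine model: structured programs over binary trees, with a step count

A program works on a store of variables `X 0, X 1, …` that hold finite binary trees; it reads its
input from `X 0` and leaves its output in `X 0`.  Writing a value costs one plus the size of the
whole value written, and testing a variable costs one.  Polynomial time in this model is the usual
polynomial time: a multi-tape Turing machine holds each of the finitely many variables of a program
on a tape of its own and simulates the program with polynomial overhead, and conversely
(a tape is two lists of symbols). -/

/-- Finite binary trees, the data on which programs operate. -/
inductive Data : Type
  | nil : Data
  | pair : Data → Data → Data

namespace Data

/-- The size of a tree: its number of nodes, leaves included. -/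
def size : Data → ℕ
  | nil => 1
  | pair a b => 1 + a.size + b.size

/-- The left subtree (the tree `nil` if there is none). -/
def fst : Data → Data
  | nil => nil
  | pair a _ => a

/-- The right subtree (the tree `nil` if there is none). -/
def snd : Data → Data
  | nil => nil
  | pair _ b => b

/-- A list of trees as a tree. -/
def ofList : List Data → Data
  | [] => nil
  | a :: l => pair a (ofList l)

/-- A bit as a tree. -/
def ofBool : Bool → Data
  | false => nil
  | true => pair nil nil

/-- A natural number in unary. -/
def ofUnary (m : ℕ) : Data := ofList (List.replicate m nil)

/-- A natural number in binary, least significant bit first. -/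
def ofBinary (m : ℕ) : Data := ofList (m.bits.map ofBool)

/-- A string of `m` bits. -/
def ofBits {m : ℕ} (r : Fin m → Bool) : Data := ofList (List.ofFn fun i => ofBool (r i))

/-- A list of points of the `n`-point space `Fin n`. -/
def ofPoints {n : ℕ} (l : List (Fin n)) : Data := ofList (l.map fun i => ofUnary i)

end Data

/-- The contents of the variables. -/
abbrev Store : Type := ℕ → Data

/-- Right-hand sides of assignments. -/
inductive Expr : Type
  | nil : Expr
  | var (x : ℕ) : Expr
  | pair (x y : ℕ) : Expr
  | fst (x : ℕ) : Expr
  | snd (x : ℕ) : Expr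

/-- The value of a right-hand side. -/
def Expr.eval (s : Store) : Expr → Data
  | .nil => .nil
  | .var x => s x
  | .pair x y => .pair (s x) (s y)
  | .fst x => (s x).fst
  | .snd x => (s x).snd

/-- Programs.  A test asks whether a variable is different from `nil`. -/
inductive Prog : Type
  | skip : Prog
  | assign (x : ℕ) (e : Expr) : Prog
  | seq (p q : Prog) : Prog
  | cond (x : ℕ) (p q : Prog) : Prog
  | loop (x : ℕ) (p : Prog) : Prog

/-- `Exec p s s' c`: started on the store `s`, the program `p` halts on the store `s'`, at cost `c`.
Here `cond x p q` is `if x ≠ nil then p else q`, and `loop x p` is `while x ≠ nil do p`. -/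
inductive Exec : Prog → Store → Store → ℕ → Prop
  | skip (s : Store) : Exec .skip s s 1
  | assign (x : ℕ) (e : Expr) (s : Store) :
      Exec (.assign x e) s (Function.update s x (e.eval s)) (1 + (e.eval s).size)
  | seq {p q : Prog} {s s' s'' : Store} {a b : ℕ} :
      Exec p s s' a → Exec q s' s'' b → Exec (.seq p q) s s'' (a + b)
  | condTrue {x : ℕ} {p q : Prog} {s s' : Store} {a : ℕ} :
      s x ≠ .nil → Exec p s s' a → Exec (.cond x p q) s s' (1 + a)
  | condFalse {x : ℕ} {p q : Prog} {s s' : Store} {a : ℕ} :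
      s x = .nil → Exec q s s' a → Exec (.cond x p q) s s' (1 + a)
  | loopDone {x : ℕ} {p : Prog} {s : Store} :
      s x = .nil → Exec (.loop x p) s s 1
  | loopStep {x : ℕ} {p : Prog} {s s' s'' : Store} {a b : ℕ} :
      s x ≠ .nil → Exec p s s' a → Exec (.loop x p) s' s'' b →
      Exec (.loop x p) s s'' (1 + a + b)

/-- The store at the start: the input is in variable `0`, every other variable is `nil`. -/
def initStore (input : Data) : Store := Function.update (fun _ => Data.nil) 0 input

/-- On the given input the program `p` halts at cost at most `t` with the given output. -/
def Prog.Outputs (p : Prog) (input output : Data) (t : ℕ) : Prop :=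
  ∃ (s : Store) (c : ℕ), Exec p (initStore input) s c ∧ c ≤ t ∧ s 0 = output

/-! ### Finite metric spaces with a bit representation -/

/-- A metric with rational values on the `n`-point space `Fin n`, given by its bit representation:
natural numbers `num i j` over a common denominator `den`. -/
structure RationalMetric (n : ℕ) where
  num : Fin n → Fin n → ℕ
  den : ℕ
  den_pos : 0 < den
  num_self : ∀ i, num i i = 0
  eq_of_num_eq_zero : ∀ i j, num i j = 0 → i = j
  symm : ∀ i j, num i j = num j i
  triangle : ∀ i j l, num i l ≤ num i j + num j l

namespace RationalMetric

variable {n : ℕ}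

/-- The distance function. -/
def dist (M : RationalMetric n) (i j : Fin n) : ℝ := (M.num i j : ℝ) / (M.den : ℝ)

/-- All distances are at most one, the standing normalisation of the `k`-server problem. -/
def DistLeOne (M : RationalMetric n) : Prop := ∀ i j, M.dist i j ≤ 1

/-- The instance consisting of the metric space and the number `k`: the numbers `n` and `k` (in
unary), the common denominator and the matrix of numerators (in binary). -/
def encode (M : RationalMetric n) (k : ℕ) : Data :=
  .ofList [.ofUnary n, .ofUnary k, .ofBinary M.den,
    .ofList (List.ofFn fun i => .ofList (List.ofFn fun j => .ofBinary (M.num i j)))]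

/-- The size of the representation of the instance. -/
def inputSize (M : RationalMetric n) (k : ℕ) : ℕ := (M.encode k).size

end RationalMetric

/-- The average of `g` over a uniformly random string of `m` bits. -/
def expect {m : ℕ} (g : (Fin m → Bool) → ℝ) : ℝ := (∑ r : Fin m → Bool, g r) / 2 ^ m

/-! ### The `k`-server problem -/

variable {n k : ℕ}

/-- The cost of a minimum weight matching between the configurations `C` and `C'`. -/
def matchDist (M : RationalMetric n) (C C' : Fin k → Fin n) : ℝ :=
  ⨅ σ : Equiv.Perm (Fin k), ∑ i, M.dist (C i) (C' (σ i))

open Classical in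
/-- The loss of the configuration `C` for a request at `x`: zero if there is a server at `x`, and
twice the distance from `x` to the nearest server otherwise. -/
def serverLoss (M : RationalMetric n) (x : Fin n) (C : Fin k → Fin n) : ℝ :=
  if x ∈ Set.range C then 0 else 2 * ⨅ i, M.dist (C i) x

/-- The cost of serving `T` requests `x 0, …, x (T - 1)`, with the configurations
`C 0, …, C (T - 1)` right after the requests; the first configuration is chosen for free. -/
def serverCost (M : RationalMetric n) (T : ℕ) (x : ℕ → Fin n) (C : ℕ → Fin k → Fin n) : ℝ :=
  ∑ t ∈ Finset.range T, serverLoss M (x t) (C t) +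
    ∑ t ∈ Finset.Ico 1 T, matchDist M (C t) (C (t - 1))

/-- The cost of the best fixed configuration of `k` servers in hindsight. -/
def bestStaticCost (M : RationalMetric n) (k T : ℕ) (x : ℕ → Fin n) : ℝ :=
  ⨅ C : Fin k → Fin n, ∑ t ∈ Finset.range T, serverLoss M (x t) C

/-- What an online algorithm knows when it answers a request: the instance, the time horizon, the
requests up to and including the current one, and its random bits. -/
def serverInput {m : ℕ} (M : RationalMetric n) (k T : ℕ) (past : List (Fin n))
    (r : Fin m → Bool) : Data :=
  .ofList [M.encode k, .ofUnary T, .ofPoints past, .ofBits r]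

/-- An efficient randomised online algorithm for the `k`-server problem (on metrics with distances
at most one and with `1 ≤ k ≤ n`): `config M k T r past` is the configuration it moves to after the
requests `past`, if `T` is the time horizon and `r` its string of random bits, the same string in
all rounds.  In each round the new configuration is computed in time polynomial in `T` and in the
size of the representation of the instance. -/
structure KServerAlgorithm where
  prog : Prog
  coins : Polynomial ℕ
  time : Polynomial ℕ
  config : ∀ {n : ℕ} [NeZero n] (M : RationalMetric n) (k T : ℕ),
    (Fin (coins.eval (M.inputSize k + T)) → Bool) → List (Fin n) → Fin k → Fin n
  computes : ∀ {n : ℕ} [NeZero n] (M : RationalMetric n) (k T : ℕ), M.DistLeOne → 1 ≤ k → k ≤ n →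
    ∀ (r : Fin (coins.eval (M.inputSize k + T)) → Bool) (past : List (Fin n)),
      past ≠ [] → past.length ≤ T →
      prog.Outputs (serverInput M k T past r) (.ofPoints (List.ofFn (config M k T r past)))
        (time.eval (M.inputSize k + T))

/-- The configuration of the algorithm in round `t` on the request sequence `x`, which depends only
on the requests `x 0, …, x t`. -/
def KServerAlgorithm.configAt (A : KServerAlgorithm) [NeZero n] (M : RationalMetric n) (k T : ℕ)
    (r : Fin (A.coins.eval (M.inputSize k + T)) → Bool) (x : ℕ → Fin n) (t : ℕ) : Fin k → Fin n :=
  A.config M k T r ((List.range (t + 1)).map x)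

/-- The algorithm has regret at most `R n T` on `n`-point spaces and time horizon `T`, against every
request sequence fixed in advance. -/
def KServerAlgorithm.HasRegret (A : KServerAlgorithm) (R : ℕ → ℕ → ℝ) : Prop :=
  ∀ (n : ℕ) [NeZero n] (M : RationalMetric n) (k T : ℕ), M.DistLeOne → 1 ≤ k → k ≤ n → 1 ≤ T →
    ∀ x : ℕ → Fin n,
      expect (fun r => serverCost M T x (A.configAt M k T r x)) ≤ bestStaticCost M k T x + R n T

/-! ### The `k`-median problem -/

/-- The value of a set `A` of centres: the sum of the distances of all points to `A`. -/
def medianVal (M : RationalMetric n) (A : Finset (Fin n)) : ℝ :=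
  ∑ x : Fin n, ⨅ a : A, M.dist x a

/-- The minimal value of a set of exactly `k` centres. -/
def medianOpt (M : RationalMetric n) (k : ℕ) : ℝ :=
  ⨅ A : {A : Finset (Fin n) // A.card = k}, medianVal M A.1

/-- A randomised polynomial-time algorithm for the `k`-median problem (`1 ≤ k ≤ n`): with the random
bits `r` it outputs the set `sol M k r` of exactly `k` centres, listed without repetition. -/
structure KMedianAlgorithm where
  prog : Prog
  coins : Polynomial ℕ
  time : Polynomial ℕ
  sol : ∀ {n : ℕ} (M : RationalMetric n) (k : ℕ),
    (Fin (coins.eval (M.inputSize k)) → Bool) → Finset (Fin n)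
  computes : ∀ {n : ℕ} (M : RationalMetric n) (k : ℕ), 1 ≤ k → k ≤ n →
    ∀ r : Fin (coins.eval (M.inputSize k)) → Bool,
      (sol M k r).card = k ∧
      ∃ l : List (Fin n), l.Nodup ∧ l.toFinset = sol M k r ∧
        prog.Outputs (.ofList [M.encode k, .ofBits r]) (.ofPoints l) (time.eval (M.inputSize k))

/-- The expected value of the output is at most `ρ` times the optimum, on every instance. -/
def KMedianAlgorithm.IsApprox (B : KMedianAlgorithm) (ρ : ℝ) : Prop :=
  ∀ (n : ℕ) (M : RationalMetric n) (k : ℕ), 1 ≤ k → k ≤ n →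
    expect (fun r => medianVal M (B.sol M k r)) ≤ ρ * medianOpt M k

end KServer

end

/-! A low-regret server algorithm facing random requests must find good centres. Let the requests be
independent and uniform on the `n` points. The configuration `C_t` does not depend on the request
`x_{t+1}`, so the expected distance from `x_{t+1}` to `C_t` is `1/n` times the expected value of
`C_t`. On the other hand this distance is at most the distance from `x_{t+1}` to `C_{t+1}` plus the
movement between `C_t` and `C_{t+1}`, and the algorithm pays for both
(`sum_configDist_le_serverCost`). A fixed configuration pays, per request, on average twice `1/n`
times its value; this is where the factor 2 comes from. Hence the configuration in a random round
has expected value at most about twice the optimum plus `n` times the regret per round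
(`Inst.avg_configVal_le`).

The last term has to be small compared with the optimum for a polynomial horizon, while distances
must be at most one. Both are achieved with centres chosen greedily, each as far as possible from
the previous ones. If they leave a radius `r > 0`, then together with a farthest point they form `k
+ 1` points at mutual distance at least `r`, so any `k` centres are at distance at least `r/2` from
some point (`Inst.exists_far_point`). Cut the metric off at a length between `n r` and `2 n r` and
make this the unit. Then every configuration has value at least `1/(4n)`
(`Inst.one_le_configVal_capped`), and a horizon polynomial in `n` makes the regret negligible
(`regret_bound`). The cut-off does no harm: a configuration that is a full unit away from some point
has capped value at least one, so the greedy centres, of value at most `n r`, are no worse; for any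
other configuration the distances to the nearest centres are the true ones
(`Inst.medianVal_fill_le`). If `r = 0`, then `k = n` and all points are centres.

Random points and rounds are obtained from bits by reduction modulo `N`, with relative error `2 ^
(-c)` (`avg_sample_bounds`). Polynomial running time is handled by the relation `PT`. Its programs
start and end with every variable except `0` empty, so they can be concatenated; `PT` is closed
under pairing, case distinction and loops whose states stay polynomially bounded, and the algorithm
is assembled from these operations (`PT.centres`). -/

noncomputable section

namespace KServer

/-! ### Programs that run cleanly -/

/-- All variables of the program are below this number. -/
def Expr.bound : Expr → ℕ
  | .nil => 0
  | .var x => x + 1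
  | .pair x y => max (x + 1) (y + 1)
  | .fst x => x + 1
  | .snd x => x + 1

/-- All variables of the program are below this number. -/
def Prog.bound : Prog → ℕ
  | .skip => 0
  | .assign x e => max (x + 1) e.bound
  | .seq p q => max p.bound q.bound
  | .cond x p q => max (x + 1) (max p.bound q.bound)
  | .loop x p => max (x + 1) p.bound

theorem Expr.eval_congr {e : Expr} {N : ℕ} (h : e.bound ≤ N) {s s' : Store}
    (hs : ∀ x < N, s x = s' x) : e.eval s = e.eval s' := by
  cases e <;> simp only [Expr.bound, max_le_iff] at h <;> simp only [Expr.eval]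
  · rw [hs _ (by omega)]
  · rw [hs _ (by omega), hs _ (by omega)]
  · rw [hs _ (by omega)]
  · rw [hs _ (by omega)]

/-- A program neither reads nor changes the variables that do not occur in it. -/
theorem Exec.frame {p : Prog} {s s' : Store} {c : ℕ} (h : Exec p s s' c) {N : ℕ} :
    p.bound ≤ N → ∀ u : Store, (∀ x < N, u x = s x) →
      Exec p u (fun x => if x < N then s' x else u x) c := by
  have key : ∀ {s u : Store}, (∀ x < N, u x = s x) →
      (fun x => if x < N then s x else u x) = u := by
    intro s u hu
    funext x
    by_cases hx : x < N
    · simp [hx, hu x hx]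
    · simp [hx]
  induction h with
  | skip s =>
    intro _ u hu
    rw [key hu]
    exact .skip u
  | assign x e s =>
    intro hb u hu
    simp only [Prog.bound, max_le_iff] at hb
    have he := Expr.eval_congr hb.2 hu
    have := Exec.assign x e u
    rw [he] at this
    convert this using 1
    funext y
    by_cases hy : y = x
    · subst hy
      simp only [Function.update_self]
      rw [if_pos (by omega)]
    · simp only [Function.update_of_ne hy]
      split_ifs with h
      · exact (hu y h).symm
      · rfl
  | seq h₁ h₂ ih₁ ih₂ =>
    intro hb u hu
    simp only [Prog.bound, max_le_iff] at hb
    have e₁ := ih₁ hb.1 u hu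
    have e₂ := ih₂ hb.2 (fun x => if x < N then _ else u x) (fun x hx => if_pos hx)
    convert Exec.seq e₁ e₂ using 1
    funext x
    by_cases hx : x < N <;> simp [hx]
  | condTrue hx h ih =>
    intro hb u hu
    simp only [Prog.bound, max_le_iff] at hb
    exact .condTrue (by rwa [hu _ (by omega)]) (ih hb.2.1 u hu)
  | condFalse hx h ih =>
    intro hb u hu
    simp only [Prog.bound, max_le_iff] at hb
    exact .condFalse (by rwa [hu _ (by omega)]) (ih hb.2.2 u hu)
  | loopDone hx =>
    intro hb u hu
    simp only [Prog.bound, max_le_iff] at hb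
    rw [key hu]
    exact .loopDone (by rwa [hu _ (by omega)])
  | loopStep hx h₁ h₂ ih₁ ih₂ =>
    intro hb u hu
    have hb' := hb
    simp only [Prog.bound, max_le_iff] at hb
    have e₁ := ih₁ hb.2 u hu
    have e₂ := ih₂ hb' (fun x => if x < N then _ else u x) (fun x hx => if_pos hx)
    convert Exec.loopStep (by rwa [hu _ (by omega)]) e₁ e₂ using 1
    funext x
    by_cases hx : x < N <;> simp [hx]

theorem Data.one_le_size (d : Data) : 1 ≤ d.size := by
  cases d <;> simp only [Data.size] <;> omega

/-- The values at the end are no larger than the values at the start plus the cost. -/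
theorem Exec.size_le {p : Prog} {s s' : Store} {c : ℕ} (h : Exec p s s' c) (x : ℕ) :
    (s' x).size ≤ (s x).size + c := by
  induction h with
  | skip s => omega
  | assign y e s =>
    by_cases hx : x = y
    · subst hx
      simp only [Function.update_self]
      omega
    · simp only [Function.update_of_ne hx]
      omega
  | seq _ _ ih₁ ih₂ => omega
  | condTrue _ _ ih => omega
  | condFalse _ _ ih => omega
  | loopDone _ => omega
  | loopStep _ _ _ ih₁ ih₂ => omega

/-- Writing a value costs at least its size. Polynomial running time thus forces polynomial output
size, which keeps compositions polynomial. -/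
theorem Exec.output_size_le {p : Prog} {a b : Data} {c : ℕ}
    (h : Exec p (initStore a) (initStore b) c) : b.size ≤ a.size + c := by
  simpa [initStore] using h.size_le 0

/-- A store with given values of three variables, all others `nil`. -/
def store3 (N : ℕ) (a b c : Data) : Store := fun x =>
  if x = 0 then a else if x = N then b else if x = N + 1 then c else .nil

theorem initStore_eq_store3 (N : ℕ) (a : Data) :
    initStore a = store3 N a .nil .nil := by
  funext x
  by_cases hx : x = 0
  · subst hx; simp [initStore, store3]
  · simp [initStore, store3, hx]

/-- A clean run in the presence of two further variables. -/
theorem Exec.store3 {p : Prog} {a a' : Data} {t : ℕ}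
    (h : Exec p (initStore a) (initStore a') t) {N : ℕ} (hN : 0 < N) (hp : p.bound ≤ N)
    (b c : Data) : Exec p (store3 N a b c) (store3 N a' b c) t := by
  have := h.frame hp (KServer.store3 N a b c) (by
    intro x hx
    by_cases h0 : x = 0
    · subst h0; simp [KServer.store3, initStore]
    · have h1 : x ≠ N := by omega
      have h2 : x ≠ N + 1 := by omega
      simp [KServer.store3, initStore, h0, h1, h2])
  convert this using 1
  funext x
  by_cases h0 : x = 0
  · subst h0; simp [KServer.store3, initStore, hN]
  · by_cases hx : x < N
    · have h1 : x ≠ N := by omega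
      have h2 : x ≠ N + 1 := by omega
      simp [KServer.store3, initStore, h0, h1, h2]
    · simp [KServer.store3, h0, hx]

theorem Exec.assign_eq {x : ℕ} {e : Expr} {s s' : Store} {c : ℕ}
    (hs : s' = Function.update s x (e.eval s)) (hc : c = 1 + (e.eval s).size) :
    Exec (.assign x e) s s' c := by
  subst hs hc
  exact .assign x e s

theorem store3_update_zero {N : ℕ} (a a' b c : Data) :
    store3 N a' b c = Function.update (store3 N a b c) 0 a' := by
  funext x
  by_cases h0 : x = 0
  · subst h0; simp [store3]
  · simp [store3, h0]

theorem store3_update_fst {N : ℕ} (hN : 0 < N) (a b b' c : Data) :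
    store3 N a b' c = Function.update (store3 N a b c) N b' := by
  funext x
  by_cases h0 : x = N
  · subst h0; simp [store3, hN.ne']
  · simp [store3, h0]

theorem store3_update_snd {N : ℕ} (a b c c' : Data) :
    store3 N a b c' = Function.update (store3 N a b c) (N + 1) c' := by
  funext x
  by_cases h0 : x = N + 1
  · subst h0; simp [store3]
  · simp [store3, h0]

theorem store3_zero {N : ℕ} (a b c : Data) : store3 N a b c 0 = a := by simp [store3]
theorem store3_fst {N : ℕ} (hN : 0 < N) (a b c : Data) : store3 N a b c N = b := by
  simp [store3, hN.ne']
theorem store3_snd {N : ℕ} (a b c : Data) : store3 N a b c (N + 1) = c := by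
  simp [store3]

/-- A program that resets the variables `1, …, m` to `nil`. -/
def Prog.clear : ℕ → Prog
  | 0 => .skip
  | m + 1 => .seq (Prog.clear m) (.assign (m + 1) .nil)

theorem Prog.exec_clear (m : ℕ) (s : Store) :
    Exec (Prog.clear m) s (fun x => if 0 < x ∧ x ≤ m then .nil else s x) (1 + 2 * m) := by
  induction m with
  | zero =>
    have : (fun x => if 0 < x ∧ x ≤ 0 then Data.nil else s x) = s := by
      funext x
      rw [if_neg (by omega)]
    rw [this]
    exact .skip s
  | succ m ih =>
    refine Exec.seq ih (b := 2) ?_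
    refine Exec.assign_eq ?_ (by simp [Expr.eval, Data.size])
    funext x
    by_cases hx : x = m + 1
    · subst hx; simp [Expr.eval]
    · rw [Function.update_of_ne hx]
      have : (0 < x ∧ x ≤ m + 1) ↔ (0 < x ∧ x ≤ m) := by omega
      simp only [this]

/-- A run leaves rubbish only in variables that occur in the program, and these are wiped
afterwards. The additional cost depends on the program alone. -/
theorem Prog.Outputs.exec_clear {p : Prog} {a b : Data} {t : ℕ} (h : p.Outputs a b t) :
    ∃ c ≤ t + (3 + 2 * p.bound),
      Exec (.seq p (.clear (p.bound + 1))) (initStore a) (initStore b) c := by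
  obtain ⟨s, c, hs, hc, rfl⟩ := h
  refine ⟨c + (1 + 2 * (p.bound + 1)), by omega, ?_⟩
  -- The threshold `p.bound + 1` puts the output variable `0` below it even if `p` mentions no
  -- variable.
  have h1 := hs.frame (Nat.le_succ p.bound) (initStore a) (fun _ _ => rfl)
  refine Exec.seq h1 ?_
  convert Prog.exec_clear (p.bound + 1) _ using 1
  funext x
  by_cases h0 : x = 0
  · subst h0
    simp [initStore]
  · have h2 : 0 < x := Nat.pos_of_ne_zero h0
    have h3 : x < p.bound + 1 → x ≤ p.bound + 1 := fun h => h.le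
    by_cases hx : x < p.bound + 1
    · simp [initStore, h0, h2, h3 hx]
    · simp [initStore, h0, hx]

/-! ### Polynomial bounds -/

/-- The quantity `f` is bounded by a polynomial in the quantity `g`. -/
def PolyBounded {α : Type} (g f : α → ℕ) : Prop :=
  ∃ q : Polynomial ℕ, ∀ a, f a ≤ q.eval (g a)

theorem eval_mono (q : Polynomial ℕ) {x y : ℕ} (h : x ≤ y) : q.eval x ≤ q.eval y := by
  simp only [Polynomial.eval_eq_sum, Polynomial.sum]
  gcongr

namespace PolyBounded

variable {α β : Type} {g f f' : α → ℕ}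

theorem self (g : α → ℕ) : PolyBounded g g := ⟨Polynomial.X, fun a => by simp⟩

theorem const (g : α → ℕ) (m : ℕ) : PolyBounded g fun _ => m :=
  ⟨Polynomial.C m, fun a => by simp⟩

theorem add (h : PolyBounded g f) (h' : PolyBounded g f') :
    PolyBounded g fun a => f a + f' a := by
  obtain ⟨q, hq⟩ := h
  obtain ⟨q', hq'⟩ := h'
  exact ⟨q + q', fun a => by simpa using add_le_add (hq a) (hq' a)⟩

theorem mul (h : PolyBounded g f) (h' : PolyBounded g f') :
    PolyBounded g fun a => f a * f' a := by
  obtain ⟨q, hq⟩ := h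
  obtain ⟨q', hq'⟩ := h'
  exact ⟨q * q', fun a => by simpa using Nat.mul_le_mul (hq a) (hq' a)⟩

theorem mono (h : PolyBounded g f) (hf : ∀ a, f' a ≤ f a) : PolyBounded g f' := by
  obtain ⟨q, hq⟩ := h
  exact ⟨q, fun a => (hf a).trans (hq a)⟩

theorem trans {f' : α → ℕ} (h : PolyBounded g f) (h' : PolyBounded f f') :
    PolyBounded g f' := by
  obtain ⟨q, hq⟩ := h
  obtain ⟨q', hq'⟩ := h'
  exact ⟨q'.comp q, fun a => (hq' a).trans (by
    rw [Polynomial.eval_comp]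
    exact eval_mono _ (hq a))⟩

theorem reindex (h : PolyBounded g f) (φ : β → α) :
    PolyBounded (fun b => g (φ b)) fun b => f (φ b) := by
  obtain ⟨q, hq⟩ := h
  exact ⟨q, fun b => hq (φ b)⟩

theorem eval (h : PolyBounded g f) (q : Polynomial ℕ) :
    PolyBounded g fun a => q.eval (f a) := h.trans ⟨q, fun _ => le_rfl⟩

end PolyBounded

/-! ### Polynomial time computability -/

/-- From the representation `e a`, the representation `g a` is computed in polynomial time, by one
program for all `a`. -/
def PT {α : Type} (e g : α → Data) : Prop :=
  ∃ (p : Prog) (t : α → ℕ), PolyBounded (fun a => (e a).size) t ∧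
    ∀ a, ∃ c ≤ t a, Exec p (initStore (e a)) (initStore (g a)) c

namespace PT

variable {α β γ : Type} {e g h : α → Data}

theorem size (hg : PT e g) : PolyBounded (fun a => (e a).size) fun a => (g a).size := by
  obtain ⟨p, t, ht, hp⟩ := hg
  refine ((PolyBounded.self _).add ht).mono fun a => ?_
  obtain ⟨c, hc, hx⟩ := hp a
  exact hx.output_size_le.trans (Nat.add_le_add_left hc _)

theorem refl (e : α → Data) : PT e e :=
  ⟨.skip, fun _ => 1, .const _ 1, fun _ => ⟨1, le_rfl, .skip _⟩⟩

theorem trans (hg : PT e g) (hh : PT g h) : PT e h := by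
  have hs := hg.size
  obtain ⟨p, t, ht, hp⟩ := hg
  obtain ⟨p', t', ht', hp'⟩ := hh
  refine ⟨.seq p p', fun a => t a + t' a, ht.add (hs.trans ht'), fun a => ?_⟩
  obtain ⟨c, hc, hx⟩ := hp a
  obtain ⟨c', hc', hx'⟩ := hp' a
  exact ⟨c + c', add_le_add hc hc', hx.seq hx'⟩

theorem reindex (hg : PT e g) (φ : β → α) : PT (fun b => e (φ b)) fun b => g (φ b) := by
  obtain ⟨p, t, ht, hp⟩ := hg
  exact ⟨p, fun b => t (φ b), ht.reindex φ, fun b => hp (φ b)⟩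

/-- A single assignment to the variable `0`. -/
theorem of_expr (x : Expr) (hg : ∀ a, g a = x.eval (initStore (e a)))
    (hs : PolyBounded (fun a => (e a).size) fun a => (g a).size) : PT e g := by
  refine ⟨.assign 0 x, fun a => 1 + (g a).size, (PolyBounded.const _ 1).add hs, fun a => ?_⟩
  refine ⟨_, le_rfl, Exec.assign_eq ?_ (congrArg (1 + ·.size) (hg a))⟩
  rw [← hg]
  simp [initStore]

theorem nil : PT e fun _ => .nil :=
  of_expr .nil (fun _ => rfl) (PolyBounded.const _ 1)

theorem _root_.KServer.Data.size_fst_le (d : Data) : d.fst.size ≤ d.size := by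
  cases d <;> simp only [Data.fst, Data.size] <;> omega

theorem _root_.KServer.Data.size_snd_le (d : Data) : d.snd.size ≤ d.size := by
  cases d <;> simp only [Data.snd, Data.size] <;> omega

theorem fst (hg : PT e g) : PT e fun a => (g a).fst :=
  hg.trans (of_expr (.fst 0) (fun _ => rfl) ((PolyBounded.self _).mono fun a => (g a).size_fst_le))

theorem snd (hg : PT e g) : PT e fun a => (g a).snd :=
  hg.trans (of_expr (.snd 0) (fun _ => rfl) ((PolyBounded.self _).mono fun a => (g a).size_snd_le))

/-- Variable `N` keeps a copy of the input while `p` runs, and `N + 1` keeps the first result while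
`q` runs on the restored input. Neither program touches these variables because `N` bounds both; `1
≤ N` separates them from variable `0`. -/
theorem pair (hg : PT e g) (hh : PT e h) : PT e fun a => .pair (g a) (h a) := by
  have sg := hg.size
  have sh := hh.size
  obtain ⟨p, t, ht, hp⟩ := hg
  obtain ⟨q, t', ht', hq⟩ := hh
  set N := max (max p.bound q.bound) 1 with hN
  have hN0 : 0 < N := by omega
  have hpN : p.bound ≤ N := by omega
  have hqN : q.bound ≤ N := by omega
  refine ⟨.seq (.assign N (.var 0)) (.seq p (.seq (.assign (N + 1) (.var 0))
    (.seq (.assign 0 (.var N)) (.seq (.assign N .nil) (.seq q (.seq (.assign 0 (.pair (N + 1) 0))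
    (.assign (N + 1) .nil))))))),
    fun a => (1 + (e a).size) + (t a + ((1 + (g a).size) + ((1 + (e a).size) + (2 + (t' a +
      ((1 + (1 + (g a).size + (h a).size)) + 2)))))), ?_, fun a => ?_⟩
  · have one := PolyBounded.const (fun a => (e a).size) 1
    have two := PolyBounded.const (fun a => (e a).size) 2
    have se := PolyBounded.self (fun a => (e a).size)
    exact (one.add se).add (ht.add ((one.add sg).add ((one.add se).add (two.add (ht'.add
      ((one.add ((one.add sg).add sh)).add two))))))
  · obtain ⟨c, hc, hx⟩ := hp a
    obtain ⟨c', hc', hy⟩ := hq a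
    refine ⟨(1 + (e a).size) + (c + ((1 + (g a).size) + ((1 + (e a).size) + (2 + (c' +
      ((1 + (1 + (g a).size + (h a).size)) + 2)))))), by simp only; omega, ?_⟩
    rw [initStore_eq_store3 N, initStore_eq_store3 N]
    refine .seq (s' := store3 N (e a) (e a) .nil) (.assign_eq ?_ ?_) ?_
    · simp only [Expr.eval, store3_zero]; exact store3_update_fst hN0 ..
    · simp only [Expr.eval, store3_zero]
    refine .seq (hx.store3 hN0 hpN _ _) ?_
    refine .seq (s' := store3 N (g a) (e a) (g a)) (.assign_eq ?_ ?_) ?_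
    · simp only [Expr.eval, store3_zero]; exact store3_update_snd ..
    · simp only [Expr.eval, store3_zero]
    refine .seq (s' := store3 N (e a) (e a) (g a)) (.assign_eq ?_ ?_) ?_
    · simp only [Expr.eval, store3_fst hN0]; exact store3_update_zero ..
    · simp only [Expr.eval, store3_fst hN0]
    refine .seq (s' := store3 N (e a) .nil (g a)) (.assign_eq ?_ ?_) ?_
    · exact store3_update_fst hN0 ..
    · simp only [Expr.eval, Data.size]
    refine .seq (hy.store3 hN0 hqN _ _) ?_
    refine .seq (s' := store3 N (.pair (g a) (h a)) .nil (g a)) (.assign_eq ?_ ?_) ?_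
    · simp only [Expr.eval, store3_zero, store3_snd]; exact store3_update_zero ..
    · simp only [Expr.eval, store3_zero, store3_snd, Data.size]
    refine .assign_eq ?_ ?_
    · exact store3_update_snd ..
    · simp only [Expr.eval, Data.size]

/-- Choice between two values. -/
theorem ite {c : α → Data} (hc : PT e c) (hg : PT e g) (hh : PT e h) [∀ a, Decidable (c a = .nil)] :
    PT e fun a => if c a = .nil then h a else g a := by
  refine ((hc.pair (hg.pair hh))).trans ?_
  refine ⟨.seq (.assign 1 (.fst 0)) (.seq (.assign 0 (.snd 0)) (.seq (.cond 1 (.assign 0 (.fst 0))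
    (.assign 0 (.snd 0))) (.assign 1 .nil))),
    fun a => 10 * (c a).size + 10 * (g a).size + 10 * (h a).size + 20, ?_, fun a => ?_⟩
  · refine ((PolyBounded.self _).mul (.const _ 20)).mono fun a => ?_
    simp only [Data.size]
    omega
  · have key : ∀ v, v = (if c a = .nil then h a else g a) → ∀ b,
        Exec (.cond 1 (.assign 0 (.fst 0)) (.assign 0 (.snd 0)))
          (store3 1 (.pair (g a) (h a)) (c a) b) (store3 1 v (c a) b) (1 + (1 + v.size)) := by
      intro v hv b
      by_cases hn : c a = .nil
      · rw [if_pos hn] at hv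
        subst hv
        refine .condFalse (by simpa [store3_fst] using hn) (.assign_eq ?_ ?_)
        · simp only [Expr.eval, store3_zero, Data.snd]; exact store3_update_zero ..
        · simp only [Expr.eval, store3_zero, Data.snd]
      · rw [if_neg hn] at hv
        subst hv
        refine .condTrue (by simpa [store3_fst] using hn) (.assign_eq ?_ ?_)
        · simp only [Expr.eval, store3_zero, Data.fst]; exact store3_update_zero ..
        · simp only [Expr.eval, store3_zero, Data.fst]
    have hv : (if c a = .nil then h a else g a).size ≤ (g a).size + (h a).size := by
      split_ifs <;> omega
    refine ⟨(1 + (c a).size) + ((1 + (1 + (g a).size + (h a).size)) +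
      ((1 + (1 + (if c a = .nil then h a else g a).size)) + 2)), by simp only; omega, ?_⟩
    rw [initStore_eq_store3 1, initStore_eq_store3 1]
    refine .seq (s' := store3 1 (.pair (c a) (.pair (g a) (h a))) (c a) .nil)
      (.assign_eq ?_ ?_) ?_
    · simp only [Expr.eval, store3_zero, Data.fst]; exact store3_update_fst Nat.one_pos ..
    · simp only [Expr.eval, store3_zero, Data.fst]
    refine .seq (s' := store3 1 (.pair (g a) (h a)) (c a) .nil) (.assign_eq ?_ ?_) ?_
    · simp only [Expr.eval, store3_zero, Data.snd]; exact store3_update_zero ..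
    · simp only [Expr.eval, store3_zero, Data.snd, Data.size]
    refine .seq (key _ rfl _) (.assign_eq ?_ ?_)
    · exact store3_update_fst Nat.one_pos ..
    · simp only [Expr.eval, Data.size]

/-- A program of the machine model, cleaned up. -/
theorem of_outputs (p : Prog) (t : α → ℕ) (ht : PolyBounded (fun a => (e a).size) t)
    (hp : ∀ a, p.Outputs (e a) (g a) (t a)) : PT e g :=
  ⟨_, fun a => t a + (3 + 2 * p.bound), ht.add (.const _ _), fun a => (hp a).exec_clear⟩

end PT

/-- Repeating a program as long as the first component of its value is different from `nil`. -/
theorem Exec.while {p : Prog} {N : ℕ} (hN : 0 < N) (hp : p.bound ≤ N) (m : ℕ) (s : ℕ → Data)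
    (c : ℕ → ℕ) (hs : ∀ i < m, (s i).fst ≠ .nil) (hm : (s m).fst = .nil)
    (hx : ∀ i < m, Exec p (initStore (s i)) (initStore (s (i + 1))) (c i)) :
    Exec (.loop N (.seq p (.assign N (.fst 0)))) (KServer.store3 N (s 0) (s 0).fst .nil)
      (KServer.store3 N (s m) .nil .nil) (1 + ∑ i ∈ Finset.range m, (2 + c i + (s (i + 1)).fst.size)) := by
  induction m generalizing s c with
  | zero =>
    rw [hm]
    exact .loopDone (store3_fst hN ..)
  | succ m ih =>
    have h1 := ih (fun i => s (i + 1)) (fun i => c (i + 1)) (fun i hi => hs _ (by omega)) hm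
      (fun i hi => hx _ (by omega))
    have h2 : Exec (.seq p (.assign N (.fst 0))) (KServer.store3 N (s 0) (s 0).fst .nil)
        (KServer.store3 N (s 1) (s 1).fst .nil) (c 0 + (1 + (s 1).fst.size)) := by
      refine .seq ((hx 0 (by omega)).store3 hN hp _ _) (.assign_eq ?_ ?_)
      · simp only [Expr.eval, store3_zero]; exact store3_update_fst hN ..
      · simp only [Expr.eval, store3_zero]
    have h3 := Exec.loopStep (by rw [store3_fst hN]; exact hs 0 (by omega)) h2 h1
    convert h3 using 1
    rw [Finset.sum_range_succ']
    simp only [zero_add]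
    ring

namespace PT

variable {α β γ : Type} {e g h : α → Data}

/-- Repeating a step, on a sequence of states of bounded size. -/
theorem repeat_step {δ : Type} {φ ψ : δ → Data} (hstep : PT φ ψ) (s : α → ℕ → Data) (m b : α → ℕ)
    (hφ : ∀ a, ∀ i < m a, ∃ d, φ d = s a i ∧ ψ d = s a (i + 1))
    (hs : ∀ a, ∀ i < m a, (s a i).fst ≠ .nil) (hm : ∀ a, (s a (m a)).fst = .nil)
    (hmb : PolyBounded (fun a => (s a 0).size) m) (hb : PolyBounded (fun a => (s a 0).size) b)
    (hsb : ∀ a, ∀ i ≤ m a, (s a i).size ≤ b a) :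
    PT (fun a => s a 0) fun a => s a (m a) := by
  obtain ⟨p, t, ⟨q, hq⟩, hp⟩ := hstep
  set N := max p.bound 1 with hN
  have hN0 : 0 < N := by omega
  have hpN : p.bound ≤ N := by omega
  refine ⟨.seq (.assign N (.fst 0)) (.loop N (.seq p (.assign N (.fst 0)))),
    fun a => (1 + (s a 0).size) + (1 + m a * (2 + q.eval (b a) + b a)), ?_, fun a => ?_⟩
  · exact ((PolyBounded.const _ 1).add (PolyBounded.self _)).add ((PolyBounded.const _ 1).add
      (hmb.mul (((PolyBounded.const _ 2).add (hb.eval q)).add hb)))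
  · have hx : ∀ i, ∃ c, i < m a → c ≤ q.eval (b a) ∧
        Exec p (initStore (s a i)) (initStore (s a (i + 1))) c := by
      intro i
      by_cases hi : i < m a
      -- The step program is only known to work on trees of the form `φ d`; `hφ` says that each
      -- state of the loop is of this form.
      · obtain ⟨d, hd, hd'⟩ := hφ a i hi
        obtain ⟨c, hc, hxc⟩ := hp d
        refine ⟨c, fun _ => ⟨(hc.trans (hq d)).trans (eval_mono q ?_), ?_⟩⟩
        · show (φ d).size ≤ b a
          rw [hd]
          exact hsb a i hi.le
        · rwa [hd, hd'] at hxc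
      · exact ⟨0, fun h => absurd h hi⟩
    choose c hc using hx
    have hw := Exec.while hN0 hpN (m a) (s a) c (hs a) (hm a) (fun i hi => (hc i hi).2)
    refine ⟨(1 + (s a 0).fst.size) + (1 + ∑ i ∈ Finset.range (m a),
      (2 + c i + (s a (i + 1)).fst.size)), ?_, ?_⟩
    · have h1 := (s a 0).size_fst_le
      have h2 : ∑ i ∈ Finset.range (m a), (2 + c i + (s a (i + 1)).fst.size) ≤
          m a * (2 + q.eval (b a) + b a) := by
        refine (Finset.sum_le_card_nsmul _ _ (2 + q.eval (b a) + b a) fun i hi => ?_).trans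
          (by simp)
        have hi := Finset.mem_range.1 hi
        have h3 := (hc i hi).1
        have h4 := (s a (i + 1)).size_fst_le.trans (hsb a (i + 1) hi)
        omega
      simp only at h1 h2 ⊢
      omega
    · rw [initStore_eq_store3 N, initStore_eq_store3 N]
      refine .seq (.assign_eq ?_ ?_) hw
      · simp only [Expr.eval, store3_zero]; exact store3_update_fst hN0 ..
      · simp only [Expr.eval, store3_zero]

theorem of_eq {g' : α → Data} (hg : PT e g) (h : ∀ a, g' a = g a) : PT e g' := by
  rwa [funext h]

end PT

/-! ### Sizes of encoded lists, and loops over lists -/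

theorem Data.length_le_size_ofList (l : List Data) : l.length ≤ (Data.ofList l).size := by
  induction l with
  | nil => simp
  | cons a l ih => simp only [List.length_cons, Data.ofList, Data.size]; omega

theorem Data.size_ofList_drop_le (l : List Data) (i : ℕ) :
    (Data.ofList (l.drop i)).size ≤ (Data.ofList l).size := by
  induction l generalizing i with
  | nil => simp
  | cons a l ih =>
    cases i with
    | zero => simp
    | succ i =>
      have := ih i
      simp only [List.drop_succ_cons, Data.ofList, Data.size]
      omega

theorem Data.size_le_of_mem {l : List Data} {d : Data} (h : d ∈ l) :
    d.size ≤ (Data.ofList l).size := by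
  induction l with
  | nil => simp at h
  | cons a l ih =>
    simp only [Data.ofList, Data.size]
    rcases List.mem_cons.1 h with rfl | h
    · omega
    · have := ih h
      omega

namespace PT

variable {α β γ : Type} {e g h : α → Data}

/-- The representation of a pair. -/
abbrev _root_.KServer.Data.prod (e : α → Data) (f : β → Data) (x : α × β) : Data :=
  .pair (e x.1) (f x.2)

/-- Iteration over a list, with an accumulator of bounded size. -/
theorem foldl {eb : β → Data} {ec : γ → Data} {init : α → β} {l : α → List γ}
    {s : α → β → γ → β} (hi : PT e fun a => eb (init a))
    (hl : PT e fun a => .ofList ((l a).map ec))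
    (hs : PT (Data.prod e (Data.prod eb ec)) fun x => eb (s x.1 x.2.1 x.2.2))
    (hb : PolyBounded (fun a => (e a).size)
      fun a => (Finset.range ((l a).length + 1)).sup
        fun i => (eb (((l a).take i).foldl (s a) (init a))).size) :
    PT e fun a => eb ((l a).foldl (s a) (init a)) := by
  -- A state holds the unread part of the list, the input and the accumulator. The loop tests the
  -- first component, so it stops exactly when the list is used up.
  let S : α → ℕ → Data := fun a i => .pair (.ofList (((l a).drop i).map ec))
    (.pair (e a) (eb (((l a).take i).foldl (s a) (init a))))
  have h0 : PT e fun a => S a 0 := by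
    refine hl.pair ((refl e).pair hi) |>.of_eq fun a => ?_
    simp [S]
  have hS0 : ∀ a, (e a).size ≤ (S a 0).size := by
    intro a
    simp only [S, Data.size]
    omega
  have up : ∀ {f : α → ℕ}, PolyBounded (fun a => (e a).size) f →
      PolyBounded (fun a => (S a 0).size) f := by
    intro f hf
    exact ((PolyBounded.self _).mono hS0).trans hf
  have hlen : PolyBounded (fun a => (e a).size) fun a => (l a).length := by
    refine hl.size.mono fun a => ?_
    simpa using Data.length_le_size_ofList ((l a).map ec)
  -- Arbitrary states with a nonempty unread list, parametrised by input, accumulator, head and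
  -- tail; `ψ` is the state after the head has been processed.
  let φ : α × β × γ × List γ → Data := fun x => .pair (.ofList ((x.2.2.1 :: x.2.2.2).map ec))
    (.pair (e x.1) (eb x.2.1))
  let ψ : α × β × γ × List γ → Data := fun x => .pair (.ofList (x.2.2.2.map ec))
    (.pair (e x.1) (eb (s x.1 x.2.1 x.2.2.1)))
  have hstep : PT φ ψ := by
    refine (refl φ).fst.snd.pair ((refl φ).snd.fst.pair ?_)
    refine ((refl φ).snd.fst.pair ((refl φ).snd.snd.pair (refl φ).fst.fst)).trans ?_
    exact hs.reindex fun x : α × β × γ × List γ => (x.1, x.2.1, x.2.2.1)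
  have hmain := repeat_step hstep S (fun a => (l a).length)
    (fun a => 1 + (Data.ofList ((l a).map ec)).size + (1 + (e a).size +
      (Finset.range ((l a).length + 1)).sup
        fun i => (eb (((l a).take i).foldl (s a) (init a))).size))
    (fun a i hi => ⟨(a, ((l a).take i).foldl (s a) (init a), (l a)[i], (l a).drop (i + 1)), by
      simp only [φ, S]
      rw [List.drop_eq_getElem_cons hi], by
      simp only [ψ, S]
      rw [List.take_add_one, List.getElem?_eq_getElem hi, Option.toList_some, List.foldl_append,
        List.foldl_cons, List.foldl_nil]⟩)
    (fun a i hi => by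
      simp only [S, Data.fst]
      rw [List.drop_eq_getElem_cons hi, List.map_cons]
      exact fun h => Data.noConfusion h)
    (fun a => by simp [S, Data.fst, Data.ofList])
    (up hlen)
    (up (((PolyBounded.const _ 1).add hl.size).add
      (((PolyBounded.const _ 1).add (PolyBounded.self _)).add hb)))
    (fun a i hi => by
      have h1 := Data.size_ofList_drop_le ((l a).map ec) i
      rw [← List.map_drop] at h1
      have h2 := Finset.le_sup (f := fun i => (eb (((l a).take i).foldl (s a) (init a))).size)
        (Finset.mem_range.2 (show i < (l a).length + 1 by omega))
      simp only [S, Data.size] at h1 h2 ⊢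
      omega)
  refine (h0.trans hmain).snd.snd.of_eq fun a => ?_
  simp [S, Data.snd]

/-- A bound for all accumulators bounds their supremum. -/
theorem _root_.KServer.PolyBounded.sup {k f : α → ℕ} {m : α → ℕ} {v : α → ℕ → ℕ}
    (hf : PolyBounded k f) (h : ∀ a, ∀ i < m a, v a i ≤ f a) :
    PolyBounded k fun a => (Finset.range (m a)).sup (v a) :=
  hf.mono fun a => Finset.sup_le fun i hi => h a i (Finset.mem_range.1 hi)

end PT

/-! ### Lists, Booleans, and numbers in unary -/

theorem Data.size_ofList (l : List Data) :
    (Data.ofList l).size = 1 + (l.map fun d => 1 + d.size).sum := by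
  induction l with
  | nil => rfl
  | cons a l ih => simp only [Data.ofList, Data.size, List.map_cons, List.sum_cons, ih]; omega

theorem Data.size_ofList_append (l l' : List Data) :
    (Data.ofList (l ++ l')).size + 1 = (Data.ofList l).size + (Data.ofList l').size := by
  simp only [Data.size_ofList, List.map_append, List.sum_append]
  omega

theorem Data.size_ofList_reverse (l : List Data) :
    (Data.ofList l.reverse).size = (Data.ofList l).size := by
  simp only [Data.size_ofList, List.map_reverse, List.sum_reverse]

theorem Data.size_ofList_le_of_sublist {l l' : List Data} (h : l.Sublist l') :
    (Data.ofList l).size ≤ (Data.ofList l').size := by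
  simp only [Data.size_ofList]
  have := (h.map fun d => 1 + d.size).sum_le_sum (fun _ _ => Nat.zero_le _)
  omega

theorem Data.size_ofList_le {l : List Data} {B : ℕ} (h : ∀ d ∈ l, d.size ≤ B) :
    (Data.ofList l).size ≤ 1 + l.length * (1 + B) := by
  rw [Data.size_ofList]
  have := List.sum_le_card_nsmul (l.map fun d => 1 + d.size) (1 + B) (by
    intro x hx
    obtain ⟨d, hd, rfl⟩ := List.mem_map.1 hx
    have := h d hd
    omega)
  simp only [List.length_map, smul_eq_mul] at this
  omega

/-- The representation of a list. -/
abbrev Data.list {γ : Type} (ec : γ → Data) (l : List γ) : Data := .ofList (l.map ec)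

theorem Data.size_ofUnary (m : ℕ) : (Data.ofUnary m).size = 1 + 2 * m := by
  rw [Data.ofUnary, Data.size_ofList]
  simp [Data.size]
  omega

theorem Data.ofUnary_succ (m : ℕ) : Data.ofUnary (m + 1) = .pair .nil (.ofUnary m) := rfl

theorem Data.snd_ofUnary (m : ℕ) : (Data.ofUnary m).snd = .ofUnary (m - 1) := by
  cases m <;> rfl

theorem Data.size_ofBool_le (b : Bool) : (Data.ofBool b).size ≤ 3 := by
  cases b <;> simp [Data.ofBool, Data.size]

namespace PT

variable {α β γ : Type} {e g h : α → Data} {f : β → Data}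

theorem const (d : Data) : PT e fun _ => d := by
  induction d with
  | nil => exact nil
  | pair a b iha ihb => exact iha.pair ihb

theorem left (hg : PT e g) : PT (Data.prod e f) fun x => g x.1 :=
  (refl (Data.prod e f)).fst.trans (hg.reindex Prod.fst)

theorem cond {b : α → Bool} (hb : PT e fun a => .ofBool (b a)) (hg : PT e g) (hh : PT e h) :
    PT e fun a => if b a = true then g a else h a := by
  classical
  refine (ite hb hg hh).of_eq fun a => ?_
  cases b a <;> simp [Data.ofBool]

theorem not {b : α → Bool} (hb : PT e fun a => .ofBool (b a)) :
    PT e fun a => .ofBool (!b a) :=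
  (cond hb (const (.ofBool false)) (const (.ofBool true))).of_eq fun a => by cases b a <;> rfl

theorem or {b b' : α → Bool} (hb : PT e fun a => .ofBool (b a)) (hb' : PT e fun a => .ofBool (b' a)) :
    PT e fun a => .ofBool (b a || b' a) :=
  (cond hb (const (.ofBool true)) hb').of_eq fun a => by cases b a <;> rfl

/-- Iteration, with an accumulator of bounded size. -/
theorem iterate {eb : β → Data} {m : α → ℕ} {init : α → β} {s : α → β → β}
    (hm : PT e fun a => .ofUnary (m a)) (hi : PT e fun a => eb (init a))
    (hs : PT (Data.prod e eb) fun x => eb (s x.1 x.2))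
    {b : α → ℕ} (hb : PolyBounded (fun a => (e a).size) b)
    (hsb : ∀ a, ∀ i ≤ m a, (eb ((s a)^[i] (init a))).size ≤ b a) :
    PT e fun a => eb ((s a)^[m a] (init a)) := by
  have key : ∀ (F : β → β) (i : ℕ) (x : β),
      (List.replicate i ()).foldl (fun b _ => F b) x = F^[i] x := by
    intro F i
    induction i with
    | zero => simp
    | succ i ih => intro x; simp [List.replicate_succ, ih]
  -- A number in unary is a list of `nil`s, so counting is folding over a list of units.
  have := foldl (e := e) (eb := eb) (ec := fun _ : Unit => Data.nil) (init := init)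
    (l := fun a => List.replicate (m a) ()) (s := fun a b _ => s a b) hi
    (hm.of_eq fun a => by simp [Data.ofUnary])
    (((refl (Data.prod e (Data.prod eb fun _ : Unit => Data.nil))).fst.pair
      (refl (Data.prod e (Data.prod eb fun _ : Unit => Data.nil))).snd.fst).trans
      (hs.reindex fun x : α × β × Unit => (x.1, x.2.1)))
    (hb.sup fun a i hi => by
      simp only [List.length_replicate] at hi
      rw [List.take_replicate, key]
      exact hsb a _ (by omega))
  exact this.of_eq fun a => by rw [key]

theorem foldl_cons_eq (l acc : List γ) : l.foldl (fun b c => c :: b) acc = l.reverse ++ acc := by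
  induction l generalizing acc with
  | nil => rfl
  | cons c l ih => simp [ih]

theorem reverse {ec : γ → Data} {l : α → List γ} (hl : PT e fun a => Data.list ec (l a)) :
    PT e fun a => Data.list ec (l a).reverse := by
  have := foldl (e := e) (eb := Data.list ec) (ec := ec) (init := fun _ => []) (l := l)
    (s := fun _ b c => c :: b) nil hl
    ((refl _).snd.snd.pair (refl _).snd.fst)
    (hl.size.sup fun a i hi => by
      rw [foldl_cons_eq, List.append_nil, Data.list, List.map_reverse,
        Data.size_ofList_reverse]
      exact Data.size_ofList_le_of_sublist ((List.take_sublist _ _).map ec))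
  exact this.of_eq fun a => by simp

/-- A fold produces the image in reverse order. Its accumulators are bounded by the length of the
list times a common bound `q` for the sizes of the single values. -/
theorem map {ec : γ → Data} {l : α → List γ} {eb : β → Data} {h : α → γ → β}
    (hl : PT e fun a => Data.list ec (l a))
    (hh : PT (Data.prod e ec) fun x => eb (h x.1 x.2)) :
    PT e fun a => Data.list eb ((l a).map (h a)) := by
  have key : ∀ (F : γ → β) (l : List γ) (acc : List β),
      l.foldl (fun b c => F c :: b) acc = (l.map F).reverse ++ acc := by
    intro F l
    induction l with
    | nil => simp
    | cons c l ih => intro acc; simp [ih]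
  obtain ⟨q, hq⟩ := hh.size
  have := foldl (e := e) (eb := Data.list eb) (ec := ec) (init := fun _ => []) (l := l)
    (s := fun a b c => h a c :: b) nil hl
    (PT.pair (((refl (Data.prod e (Data.prod (Data.list eb) ec))).fst.pair
      (refl (Data.prod e (Data.prod (Data.list eb) ec))).snd.snd).trans
      (hh.reindex fun x : α × List β × γ => (x.1, x.2.2))) (refl _).snd.fst)
    (PolyBounded.sup (f := fun a => 1 + (Data.list ec (l a)).size *
      (1 + q.eval (1 + (e a).size + (Data.list ec (l a)).size)))
      ((PolyBounded.const _ 1).add (hl.size.mul ((PolyBounded.const _ 1).add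
        ((((PolyBounded.const _ 1).add (PolyBounded.self _)).add hl.size).eval q))))
      fun a i hi => by
        rw [key, List.append_nil, Data.list, List.map_reverse, Data.size_ofList_reverse]
        refine (Data.size_ofList_le (B := q.eval (1 + (e a).size + (Data.list ec (l a)).size))
          ?_).trans ?_
        · intro d hd
          obtain ⟨b, hb, rfl⟩ := List.mem_map.1 hd
          obtain ⟨c, hc, rfl⟩ := List.mem_map.1 hb
          refine (hq (a, c)).trans (eval_mono q ?_)
          have h1 := Data.size_le_of_mem (List.mem_map_of_mem (f := ec) (List.mem_of_mem_take hc))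
          simp only [Data.size, Data.list] at h1 ⊢
          omega
        · have h1 := Data.length_le_size_ofList ((l a).map ec)
          simp only [List.length_map] at h1
          gcongr
          simp only [List.length_map, List.length_take]
          exact (min_le_right _ _).trans h1)
  refine (reverse this).of_eq fun a => ?_
  rw [key]
  simp

theorem filter {ec : γ → Data} {l : α → List γ} {p : α → γ → Bool}
    (hl : PT e fun a => Data.list ec (l a))
    (hp : PT (Data.prod e ec) fun x => .ofBool (p x.1 x.2)) :
    PT e fun a => Data.list ec ((l a).filter (p a)) := by
  have key : ∀ (F : γ → Bool) (l acc : List γ),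
      l.foldl (fun b c => if F c = true then c :: b else b) acc = (l.filter F).reverse ++ acc := by
    intro F l
    induction l with
    | nil => simp
    | cons c l ih =>
      intro acc
      by_cases hc : F c = true
      · simp [ih, hc]
      · simp [ih, hc]
  have hp' : PT (Data.prod e (Data.prod (Data.list ec) ec)) fun x => .ofBool (p x.1 x.2.2) :=
    ((refl (Data.prod e (Data.prod (Data.list ec) ec))).fst.pair
      (refl (Data.prod e (Data.prod (Data.list ec) ec))).snd.snd).trans
      (hp.reindex fun x : α × List γ × γ => (x.1, x.2.2))
  have := foldl (e := e) (eb := Data.list ec) (ec := ec) (init := fun _ => []) (l := l)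
    (s := fun a b c => if p a c = true then c :: b else b) nil hl
    ((cond hp' ((refl (Data.prod e (Data.prod (Data.list ec) ec))).snd.snd.pair
      (refl (Data.prod e (Data.prod (Data.list ec) ec))).snd.fst)
      (refl (Data.prod e (Data.prod (Data.list ec) ec))).snd.fst).of_eq fun x => by
        split_ifs <;> rfl)
    (hl.size.sup fun a i hi => by
      rw [key, List.append_nil, Data.list, List.map_reverse, Data.size_ofList_reverse]
      exact Data.size_ofList_le_of_sublist
        (((List.filter_sublist).trans (List.take_sublist _ _)).map ec))
  refine (reverse this).of_eq fun a => ?_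
  rw [key]
  simp

theorem any {ec : γ → Data} {l : α → List γ} {p : α → γ → Bool}
    (hl : PT e fun a => Data.list ec (l a))
    (hp : PT (Data.prod e ec) fun x => .ofBool (p x.1 x.2)) :
    PT e fun a => .ofBool ((l a).any (p a)) := by
  have key : ∀ (F : γ → Bool) (l : List γ) (acc : Bool),
      l.foldl (fun b c => b || F c) acc = (acc || l.any F) := by
    intro F l
    induction l with
    | nil => simp
    | cons c l ih => intro acc; simp [ih, Bool.or_assoc]
  have := foldl (e := e) (eb := Data.ofBool) (ec := ec) (init := fun _ => false) (l := l)
    (s := fun a b c => b || p a c) nil hl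
    (or (refl _).snd.fst (((refl (Data.prod e (Data.prod Data.ofBool ec))).fst.pair
      (refl (Data.prod e (Data.prod Data.ofBool ec))).snd.snd).trans
      (hp.reindex fun x : α × Bool × γ => (x.1, x.2.2))))
    ((PolyBounded.const _ 3).sup fun a i hi => Data.size_ofBool_le _)
  exact this.of_eq fun a => by rw [key]; simp

theorem all {ec : γ → Data} {l : α → List γ} {p : α → γ → Bool}
    (hl : PT e fun a => Data.list ec (l a))
    (hp : PT (Data.prod e ec) fun x => .ofBool (p x.1 x.2)) :
    PT e fun a => .ofBool ((l a).all (p a)) :=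
  (not (any (p := fun a c => !p a c) hl (not hp))).of_eq fun a => by rw [List.not_any_eq_all_not]; simp

theorem append {ec : γ → Data} {l l' : α → List γ} (hl : PT e fun a => Data.list ec (l a))
    (hl' : PT e fun a => Data.list ec (l' a)) : PT e fun a => Data.list ec (l a ++ l' a) := by
  have := foldl (e := e) (eb := Data.list ec) (ec := ec) (init := l')
    (l := fun a => (l a).reverse) (s := fun _ b c => c :: b) hl' (reverse hl)
    ((refl _).snd.snd.pair (refl _).snd.fst)
    ((hl.size.add hl'.size).sup fun a i hi => by
      rw [foldl_cons_eq, Data.list, List.map_append]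
      have h1 := Data.size_ofList_append (((l a).reverse.take i).reverse.map ec) ((l' a).map ec)
      have h2 := Data.size_ofList_le_of_sublist ((List.take_sublist i (l a).reverse).map ec)
      simp only [List.map_reverse, Data.size_ofList_reverse, Data.list] at h1 h2 ⊢
      omega)
  exact this.of_eq fun a => by simp

/-! #### Numbers in unary -/

variable {m k : α → ℕ}

theorem succ (hm : PT e fun a => .ofUnary (m a)) : PT e fun a => .ofUnary (m a + 1) :=
  nil.pair hm

theorem pred (hm : PT e fun a => .ofUnary (m a)) : PT e fun a => .ofUnary (m a - 1) :=
  hm.snd.of_eq fun _ => (Data.snd_ofUnary _).symm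

theorem unary_le (hm : PT e fun a => .ofUnary (m a)) :
    PolyBounded (fun a => (e a).size) m :=
  hm.size.mono fun a => by rw [Data.size_ofUnary]; omega

theorem add (hm : PT e fun a => .ofUnary (m a)) (hk : PT e fun a => .ofUnary (k a)) :
    PT e fun a => .ofUnary (m a + k a) := by
  have key : ∀ i x : ℕ, (fun y => y + 1)^[i] x = x + i := fun i x => by
    rw [Nat.succ_iterate]
  refine (iterate (eb := Data.ofUnary) (s := fun _ y => y + 1) hk hm (succ (refl _).snd)
    ((PolyBounded.const _ 1).add ((PolyBounded.const _ 2).mul (hm.unary_le.add hk.unary_le)))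
    fun a i hi => ?_).of_eq fun a => ?_
  · rw [key, Data.size_ofUnary]
    omega
  · rw [key]

theorem sub (hm : PT e fun a => .ofUnary (m a)) (hk : PT e fun a => .ofUnary (k a)) :
    PT e fun a => .ofUnary (m a - k a) := by
  have key : ∀ i x : ℕ, (fun y => y - 1)^[i] x = x - i := fun i x => by
    induction i generalizing x with
    | zero => rfl
    | succ i ih => rw [Function.iterate_succ_apply, ih]; omega
  refine (iterate (eb := Data.ofUnary) (s := fun _ y => y - 1) hk hm (pred (refl _).snd)
    hm.size fun a i hi => ?_).of_eq fun a => ?_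
  · rw [key, Data.size_ofUnary, Data.size_ofUnary]
    omega
  · rw [key]

theorem mul (hm : PT e fun a => .ofUnary (m a)) (hk : PT e fun a => .ofUnary (k a)) :
    PT e fun a => .ofUnary (m a * k a) := by
  have key : ∀ i x y : ℕ, (fun y => y + x)^[i] y = y + x * i := fun i x y => by
    induction i generalizing y with
    | zero => rfl
    | succ i ih => rw [Function.iterate_succ_apply, ih]; ring
  refine (iterate (eb := Data.ofUnary) (init := fun _ => 0) (s := fun a y => y + m a) hk
    nil (add (refl _).snd hm.left)
    ((PolyBounded.const _ 1).add ((PolyBounded.const _ 2).mul (hm.unary_le.mul hk.unary_le)))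
    fun a i hi => ?_).of_eq fun a => ?_
  · rw [key, Data.size_ofUnary, zero_add]
    gcongr
  · rw [key, zero_add]

theorem pos (hm : PT e fun a => .ofUnary (m a)) : PT e fun a => .ofBool (decide (0 < m a)) := by
  classical
  refine (ite hm (const (.ofBool true)) (const (.ofBool false))).of_eq fun a => ?_
  rcases Nat.eq_zero_or_pos (m a) with h | h
  · simp [h, Data.ofUnary, Data.ofList]
  · obtain ⟨j, hj⟩ := Nat.exists_eq_succ_of_ne_zero h.ne'
    simp [hj, Data.ofUnary_succ]

theorem lt (hm : PT e fun a => .ofUnary (m a)) (hk : PT e fun a => .ofUnary (k a)) :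
    PT e fun a => .ofBool (decide (m a < k a)) :=
  (pos (sub hk hm)).of_eq fun a => by simp

theorem eq (hm : PT e fun a => .ofUnary (m a)) (hk : PT e fun a => .ofUnary (k a)) :
    PT e fun a => .ofBool (decide (m a = k a)) :=
  (not (or (lt hm hk) (lt hk hm))).of_eq fun a => by
    rcases lt_trichotomy (m a) (k a) with h | h | h
    · simp [h, h.ne]
    · simp [h]
    · simp [h, h.ne']

/-- A counter that jumps back to `0` on reaching the modulus. For modulus `0` it never jumps, in
accordance with `i % 0 = i`. -/
theorem mod (hm : PT e fun a => .ofUnary (m a)) (hk : PT e fun a => .ofUnary (k a)) :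
    PT e fun a => .ofUnary (m a % k a) := by
  have key : ∀ n i : ℕ, (fun y => if decide (y + 1 = n) = true then 0 else y + 1)^[i] 0 = i % n :=
    fun n i => by
      induction i with
      | zero => simp
      | succ i ih =>
        rw [Function.iterate_succ_apply', ih]
        rcases Nat.eq_zero_or_pos n with rfl | hn
        · simp
        · have h1 := Nat.mod_lt i hn
          rw [Nat.add_mod i 1 n]
          by_cases h : i % n + 1 = n
          · rcases Nat.lt_or_ge 1 n with h2 | h2
            · simp [Nat.mod_eq_of_lt h2, h]
            · have : n = 1 := by omega
              subst this
              simp [Nat.mod_one]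
          · have h2 : 1 < n := by omega
            rw [Nat.mod_eq_of_lt h2, Nat.mod_eq_of_lt (a := i % n + 1) (by omega)]
            simp [h]
  refine (iterate (eb := Data.ofUnary) (init := fun _ => 0)
    (s := fun a y => if decide (y + 1 = k a) = true then 0 else y + 1) hm nil
    ((cond (eq (succ (refl _).snd) hk.left) nil (succ (refl _).snd)).of_eq fun x => ?_)
    hm.size fun a i hi => ?_).of_eq fun a => ?_
  · split_ifs <;> rfl
  · rw [key, Data.size_ofUnary, Data.size_ofUnary]
    have := Nat.mod_le i (k a)
    omega
  · rw [key]

theorem polynomial (hm : PT e fun a => .ofUnary (m a)) (q : Polynomial ℕ) :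
    PT e fun a => .ofUnary (q.eval (m a)) := by
  induction q using Polynomial.induction_on' with
  | add p q hp hq => exact (add hp hq).of_eq fun a => by rw [Polynomial.eval_add]
  | monomial n c =>
    have : ∀ n : ℕ, PT e fun a => .ofUnary (m a ^ n) := by
      intro n
      induction n with
      | zero => exact const (.ofUnary 1)
      | succ n ih => exact mul ih hm
    exact (mul (const (.ofUnary c)) (this n)).of_eq fun a => by rw [Polynomial.eval_monomial]

theorem range (hm : PT e fun a => .ofUnary (m a)) :
    PT e fun a => Data.list Data.ofUnary (List.range (m a)) := by
  have key : ∀ i : ℕ, (fun x : ℕ × List ℕ => (x.1 + 1, x.1 :: x.2))^[i] (0, []) =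
      (i, (List.range i).reverse) := by
    intro i
    induction i with
    | zero => rfl
    | succ i ih => rw [Function.iterate_succ_apply', ih, List.range_succ]; simp
  have := iterate (e := e) (eb := Data.prod Data.ofUnary (Data.list Data.ofUnary))
    (init := fun _ => (0, [])) (s := fun _ x => (x.1 + 1, x.1 :: x.2)) hm (const (.pair .nil .nil))
    ((succ (refl (Data.prod e (Data.prod Data.ofUnary (Data.list Data.ofUnary)))).snd.fst).pair
      ((refl (Data.prod e (Data.prod Data.ofUnary (Data.list Data.ofUnary)))).snd.fst.pair
        (refl (Data.prod e (Data.prod Data.ofUnary (Data.list Data.ofUnary)))).snd.snd))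
    (b := fun a => 1 + (1 + 2 * m a) + (1 + m a * (1 + (1 + 2 * m a))))
    (by
      have h1 := PolyBounded.const (fun a => (e a).size) 1
      have h2 := h1.add ((PolyBounded.const (fun a => (e a).size) 2).mul hm.unary_le)
      exact (h1.add h2).add (h1.add (hm.unary_le.mul (h1.add h2))))
    (fun a i hi => by
      rw [key]
      have h1 := Data.size_ofList_le (l := (List.range i).reverse.map Data.ofUnary)
        (B := 1 + 2 * m a) (by
          intro d hd
          obtain ⟨j, hj, rfl⟩ := List.mem_map.1 hd
          have := List.mem_range.1 (List.mem_reverse.1 hj)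
          rw [Data.size_ofUnary]
          omega)
      have h2 : i * (1 + (1 + 2 * m a)) ≤ m a * (1 + (1 + 2 * m a)) :=
        Nat.mul_le_mul_right _ hi
      simp only [List.length_map, List.length_reverse, List.length_range] at h1
      simp only [Data.list, Data.size, Data.size_ofUnary] at h1 ⊢
      omega)
  refine (reverse (ec := Data.ofUnary) (l := fun a => (List.range (m a)).reverse)
    (this.snd.of_eq fun a => ?_)).of_eq fun a => ?_
  · rw [key]; rfl
  · rw [List.reverse_reverse]

theorem length {ec : γ → Data} {l : α → List γ} (hl : PT e fun a => Data.list ec (l a)) :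
    PT e fun a => .ofUnary (l a).length := by
  refine (map (eb := fun _ : Unit => Data.nil) (h := fun _ _ => ()) hl nil).of_eq fun a => ?_
  simp [Data.ofUnary, Data.list]

/-- The value of a program of unary type at the elements of a list, summed up. -/
theorem sum {ec : γ → Data} {l : α → List γ} {v : α → γ → ℕ}
    (hl : PT e fun a => Data.list ec (l a))
    (hv : PT (Data.prod e ec) fun x => .ofUnary (v x.1 x.2)) :
    PT e fun a => .ofUnary ((l a).map (v a)).sum := by
  have hmap := map hl hv
  have key : ∀ (l : List ℕ) (x : ℕ), l.foldl (fun x y => x + y) x = x + l.sum := by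
    intro l
    induction l with
    | nil => simp
    | cons y l ih => intro x; simp [ih, add_assoc]
  have hsum : ∀ l : List ℕ, 2 * l.sum ≤ (Data.list Data.ofUnary l).size := by
    intro l
    induction l with
    | nil => simp
    | cons y l ih =>
      simp only [List.sum_cons, Data.list, List.map_cons, Data.ofList, Data.size,
        Data.size_ofUnary] at ih ⊢
      omega
  refine (foldl (eb := Data.ofUnary) (init := fun _ => 0) (s := fun _ x y => x + y) nil hmap
    (add (refl (Data.prod e (Data.prod Data.ofUnary Data.ofUnary))).snd.fst (refl _).snd.snd)
    (((PolyBounded.const _ 1).add hmap.size).sup fun a i hi => ?_)).of_eq fun a => ?_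
  · rw [key, Data.size_ofUnary]
    have h1 := hsum ((l a).map (v a))
    have h2 : (((l a).map (v a)).take i).sum ≤ ((l a).map (v a)).sum :=
      (List.take_sublist _ _).sum_le_sum fun _ _ => Nat.zero_le _
    simp only [Data.list] at h1 ⊢
    omega
  · rw [key, zero_add]

/-- The size of a list. -/
theorem sizeList {ec : γ → Data} {l : α → List γ} (hl : PT e fun a => Data.list ec (l a))
    (hc : PT (Data.prod e ec) fun x => .ofUnary (ec x.2).size) :
    PT e fun a => .ofUnary (Data.list ec (l a)).size := by
  refine (add (const (.ofUnary 1)) (sum (v := fun _ c => 1 + (ec c).size) hl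
    (add (const (.ofUnary 1)) hc))).of_eq fun a => ?_
  rw [Data.list, Data.size_ofList, List.map_map]
  rfl

/-- Beyond the end of the list both sides are `nil`, because `nil` is its own left and right
subtree. -/
theorem _root_.KServer.Data.fst_iterate_snd (l : List Data) (i : ℕ) :
    (Data.snd^[i] (.ofList l)).fst = l.getD i .nil := by
  induction l generalizing i with
  | nil =>
    have : Data.snd^[i] .nil = .nil := Function.iterate_fixed rfl i
    simp [Data.ofList, this, Data.fst]
  | cons d l ih =>
    cases i with
    | zero => rfl
    | succ i => simpa [Data.ofList, Data.snd] using ih i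

/-- Access to an element of a list. -/
theorem getD {l : α → List Data} (hl : PT e fun a => .ofList (l a))
    (hm : PT e fun a => .ofUnary (m a)) : PT e fun a => (l a).getD (m a) .nil := by
  have := iterate (eb := fun d : Data => d) (s := fun _ d => d.snd) hm hl (refl _).snd.snd
    hl.size fun a i hi => by
      induction i with
      | zero => exact le_rfl
      | succ i ih =>
        rw [Function.iterate_succ_apply']
        exact (Data.size_snd_le _).trans (ih (by omega))
  exact this.fst.of_eq fun a => (Data.fst_iterate_snd _ _).symm

/-! #### Numbers in binary -/

/-- With the least significant bit first, halving drops the head of the list. The case `0` is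
separate: its list of bits is empty. -/
theorem _root_.KServer.Data.snd_ofBinary (x : ℕ) : (Data.ofBinary x).snd = .ofBinary (x / 2) := by
  rcases Nat.even_or_odd' x with ⟨y, rfl | rfl⟩
  · rcases Nat.eq_zero_or_pos y with rfl | hy
    · rfl
    · rw [Data.ofBinary, Nat.bit0_bits _ hy.ne', show 2 * y / 2 = y by omega]
      rfl
  · rw [Data.ofBinary, Nat.bit1_bits, show (2 * y + 1) / 2 = y by omega]
    rfl

theorem _root_.KServer.Data.fst_ofBinary (x : ℕ) :
    (Data.ofBinary x).fst = .ofBool (decide (x % 2 = 1)) := by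
  rcases Nat.even_or_odd' x with ⟨y, rfl | rfl⟩
  · rcases Nat.eq_zero_or_pos y with rfl | hy
    · rfl
    · rw [Data.ofBinary, Nat.bit0_bits _ hy.ne', show 2 * y % 2 = 0 by omega]
      rfl
  · rw [Data.ofBinary, Nat.bit1_bits, show (2 * y + 1) % 2 = 1 by omega]
    rfl

theorem _root_.KServer.Data.ofBinary_two_mul {x : ℕ} (hx : x ≠ 0) :
    Data.ofBinary (2 * x) = .pair .nil (.ofBinary x) := by
  rw [Data.ofBinary, Nat.bit0_bits _ hx]
  rfl

theorem _root_.KServer.Data.ofBinary_eq_nil {x : ℕ} : Data.ofBinary x = .nil ↔ x = 0 := by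
  constructor
  · intro h
    have hb : x.bits = [] := by
      rw [Data.ofBinary] at h
      cases hx : x.bits with
      | nil => rfl
      | cons b l => rw [hx] at h; exact Data.noConfusion h
    have := Nat.size_eq_bits_len x
    rw [hb] at this
    exact Nat.size_eq_zero.1 this.symm
  · rintro rfl
    simp [Data.ofBinary, Data.ofList]

variable {x y : α → ℕ}

theorem bpos (hx : PT e fun a => .ofBinary (x a)) :
    PT e fun a => .ofBool (decide (0 < x a)) := by
  classical
  refine (ite hx (const (.ofBool true)) (const (.ofBool false))).of_eq fun a => ?_
  rcases Nat.eq_zero_or_pos (x a) with h | h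
  · simp [h, Data.ofBinary_eq_nil]
  · simp [h, h.ne', Data.ofBinary_eq_nil]

theorem bdouble (hx : PT e fun a => .ofBinary (x a)) : PT e fun a => .ofBinary (2 * x a) := by
  refine (cond (bpos hx) (nil.pair hx) hx).of_eq fun a => ?_
  rcases Nat.eq_zero_or_pos (x a) with h | h
  · simp [h]
  · simp [h, Data.ofBinary_two_mul h.ne']

theorem _root_.KServer.Data.size_ofBinary_half (x : ℕ) :
    (Data.ofBinary (x / 2)).size ≤ (Data.ofBinary x).size := by
  rw [← Data.snd_ofBinary]
  exact Data.size_snd_le _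

/-- One step of the comparison of two numbers, from the least significant bits on. -/
def leStep (s : ℕ × ℕ × Bool) : ℕ × ℕ × Bool :=
  (s.1 / 2, s.2.1 / 2, if decide (s.1 % 2 = 1) = true then
    (if decide (s.2.1 % 2 = 1) = true then s.2.2 else false) else
    (if decide (s.2.1 % 2 = 1) = true then true else s.2.2))

/-- Bits read later are more significant, so differing bits override the verdict so far and equal
bits keep it; the initial flag decides ties. -/
theorem leStep_iterate (i : ℕ) : ∀ s : ℕ × ℕ × Bool, s.1 < 2 ^ i → s.2.1 < 2 ^ i →
    (leStep^[i] s).2.2 = decide (s.1 < s.2.1 ∨ s.1 = s.2.1 ∧ s.2.2 = true) := by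
  induction i with
  | zero =>
    rintro ⟨x, y, b⟩ hx hy
    obtain rfl : x = 0 := by simpa using hx
    obtain rfl : y = 0 := by simpa using hy
    simp
  | succ i ih =>
    rintro ⟨x, y, b⟩ hx hy
    replace hx : x < 2 ^ i * 2 := by rwa [← pow_succ]
    replace hy : y < 2 ^ i * 2 := by rwa [← pow_succ]
    rw [Function.iterate_succ_apply, ih _ (by simp only [leStep]; omega)
      (by simp only [leStep]; omega)]
    rw [decide_eq_decide]
    simp only [leStep]
    rcases Nat.mod_two_eq_zero_or_one x with h1 | h1 <;>
      rcases Nat.mod_two_eq_zero_or_one y with h2 | h2 <;>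
      simp only [h1, h2] <;> cases b <;> simp <;> omega

theorem ble (hx : PT e fun a => .ofBinary (x a)) (hy : PT e fun a => .ofBinary (y a)) :
    PT e fun a => .ofBool (decide (x a ≤ y a)) := by
  let eb : ℕ × ℕ × Bool → Data :=
    Data.prod Data.ofBinary (Data.prod Data.ofBinary Data.ofBool)
  have hlx : PT e fun a => .ofUnary (x a).bits.length := length (ec := Data.ofBool) hx
  have hly : PT e fun a => .ofUnary (y a).bits.length := length (ec := Data.ofBool) hy
  have h1 : PT (Data.prod e eb) fun z => .ofBool (decide (z.2.1 % 2 = 1)) :=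
    (refl (Data.prod e eb)).snd.fst.fst.of_eq fun z => (Data.fst_ofBinary _).symm
  have h2 : PT (Data.prod e eb) fun z => .ofBool (decide (z.2.2.1 % 2 = 1)) :=
    (refl (Data.prod e eb)).snd.snd.fst.fst.of_eq fun z => (Data.fst_ofBinary _).symm
  have h3 : PT (Data.prod e eb) fun z => .ofBool z.2.2.2 := (refl (Data.prod e eb)).snd.snd.snd
  have hstep : PT (Data.prod e eb) fun z => eb (leStep z.2) := by
    have h4 : PT (Data.prod e eb) fun z => .ofBinary (z.2.1 / 2) :=
      (refl (Data.prod e eb)).snd.fst.snd.of_eq fun z => (Data.snd_ofBinary _).symm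
    have h5 : PT (Data.prod e eb) fun z => .ofBinary (z.2.2.1 / 2) :=
      (refl (Data.prod e eb)).snd.snd.fst.snd.of_eq fun z => (Data.snd_ofBinary _).symm
    refine (h4.pair (h5.pair (cond h1 (cond h2 h3 (const (.ofBool false)))
      (cond h2 (const (.ofBool true)) h3)))).of_eq fun z => ?_
    simp only [eb, Data.prod, leStep]
    split_ifs <;> rfl
  -- The sum of the two bit lengths serves as a number of steps that exhausts both numbers; the
  -- initial flag `true` yields `≤` rather than `<`.
  have := iterate (e := e) (eb := eb) (s := fun _ => leStep) (init := fun a => (x a, y a, true))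
    (add hlx hly) (hx.pair (hy.pair (const (.ofBool true)))) hstep
    (b := fun a => 1 + (Data.ofBinary (x a)).size + (1 + (Data.ofBinary (y a)).size + 3))
    (((PolyBounded.const _ 1).add hx.size).add (((PolyBounded.const _ 1).add hy.size).add
      (PolyBounded.const _ 3))) fun a i hi => by
        have : (Data.ofBinary (leStep^[i] (x a, y a, true)).1).size ≤ (Data.ofBinary (x a)).size ∧
            (Data.ofBinary (leStep^[i] (x a, y a, true)).2.1).size ≤
              (Data.ofBinary (y a)).size := by
          clear hi
          induction i with
          | zero => exact ⟨le_rfl, le_rfl⟩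
          | succ i ih =>
            rw [Function.iterate_succ_apply']
            exact ⟨(Data.size_ofBinary_half _).trans ih.1, (Data.size_ofBinary_half _).trans ih.2⟩
        have h4 := Data.size_ofBool_le (leStep^[i] (x a, y a, true)).2.2
        simp only [eb, Data.size]
        omega
  refine this.snd.snd.of_eq fun a => ?_
  simp only [eb, Data.prod, Data.snd]
  rw [leStep_iterate]
  · simp [le_iff_lt_or_eq]
  · rw [Nat.size_eq_bits_len, Nat.size_eq_bits_len]
    exact (Nat.lt_size_self _).trans_le (Nat.pow_le_pow_right (by norm_num) (Nat.le_add_right _ _))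
  · rw [Nat.size_eq_bits_len, Nat.size_eq_bits_len]
    exact (Nat.lt_size_self _).trans_le (Nat.pow_le_pow_right (by norm_num) (Nat.le_add_left _ _))

theorem bmin (hx : PT e fun a => .ofBinary (x a)) (hy : PT e fun a => .ofBinary (y a)) :
    PT e fun a => .ofBinary (min (x a) (y a)) :=
  (cond (ble hx hy) hx hy).of_eq fun a => by
    by_cases h : x a ≤ y a
    · simp [h]
    · simp [h, (not_le.1 h).le]

theorem sizeBinary (hx : PT e fun a => .ofBinary (x a)) :
    PT e fun a => .ofUnary (Data.ofBinary (x a)).size := by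
  refine sizeList (ec := Data.ofBool) hx ?_
  refine (cond (refl (Data.prod e Data.ofBool)).snd (const (.ofUnary 3))
    (const (.ofUnary 1))).of_eq fun z => ?_
  cases z.2 <;> rfl

end PT

/-! ### The reduction -/

/-- The numerators of the distances, on natural numbers. -/
def RationalMetric.numN {n : ℕ} (M : RationalMetric n) (i j : ℕ) : ℕ :=
  if h : i < n ∧ j < n then M.num ⟨i, h.1⟩ ⟨j, h.2⟩ else 0

theorem RationalMetric.numN_fin {n : ℕ} (M : RationalMetric n) (i j : Fin n) :
    M.numN i j = M.num i j := by simp [RationalMetric.numN]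

/-- Doubling up to a threshold. -/
def doubleStep (n : ℕ) (s : ℕ × ℕ) : ℕ × ℕ := if s.1 < n then (2 * s.1, 2 * s.2) else s

/-- An instance of the `k`-median problem. -/
structure Inst where
  n : ℕ
  k : ℕ
  M : RationalMetric n
  one_le : 1 ≤ k
  le_n : k ≤ n

namespace Inst

/-- The representation of the instance. -/
def enc (I : Inst) : Data := I.M.encode I.k

theorem n_pos (I : Inst) : 0 < I.n := lt_of_lt_of_le I.one_le I.le_n

instance (I : Inst) : NeZero I.n := ⟨I.n_pos.ne'⟩

/-- The distance (as a numerator) of `x` to the points in `A` and to `0`. -/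
def mdist (I : Inst) (A : List ℕ) (x : ℕ) : ℕ :=
  A.foldl (fun m a => min m (I.M.numN x a)) (I.M.numN x 0)

/-- A point at the largest distance from `A`. -/
def far (I : Inst) (A : List ℕ) : ℕ :=
  (List.range I.n).foldl (fun y x => if I.mdist A y ≤ I.mdist A x then x else y) 0

/-- Repeated addition of a farthest point. -/
def greedy (I : Inst) : List ℕ := (fun A => I.far A :: A)^[I.k - 1] [0]

/-- The largest distance from a point to the greedy centres. -/
def radius (I : Inst) : ℕ := I.mdist I.greedy (I.far I.greedy)

/-- The distance at which the metric is cut off: the radius times a number between `n` and `2n`. -/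
def cap (I : Inst) : ℕ :=
  if 0 < I.radius then ((doubleStep I.n)^[I.n] (1, I.radius)).2 else 1

/-- If some point is far away from `C`, replace `C` by the greedy centres. -/
def select (I : Inst) (C : List ℕ) : List ℕ :=
  if ((List.range I.n).any fun x => C.all fun a => decide (I.cap ≤ I.M.numN x a)) = true then
    I.greedy else C

/-- Add further centres to `C`, up to the number `k`. -/
def fill (I : Inst) (C : List ℕ) : List ℕ :=
  ((List.range I.n).filter (fun x => C.any fun a => decide (a = x)) ++
    (List.range I.n).filter (fun x => !C.any fun a => decide (a = x))).take I.k

end Inst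

/-- A number below `N`, computed from a string of bits. -/
def sample (N : ℕ) (l : List Bool) : ℕ :=
  l.foldl (fun v b => (2 * v + b.toNat) % N) 0

/-- A segment of a string of bits. -/
def segment (l : List Bool) (i L : ℕ) : List Bool :=
  (List.range L).map fun j => l.getD (i + j) false

/-! ### Ranges and sizes of the quantities in the reduction -/

theorem sample_lt {N : ℕ} (hN : 0 < N) (l : List Bool) : sample N l < N := by
  induction l using List.reverseRecOn with
  | nil => simpa [sample]
  | append_singleton l b _ =>
    rw [sample, List.foldl_append]
    exact Nat.mod_lt _ hN

theorem Data.size_getD_le (l : List Data) (i : ℕ) :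
    (l.getD i .nil).size ≤ (Data.ofList l).size := by
  rcases lt_or_ge i l.length with h | h
  · rw [List.getD_eq_getElem _ _ h]
    exact Data.size_le_of_mem (List.getElem_mem h)
  · rw [List.getD_eq_default _ _ h]
    simp only [Data.size]
    exact Data.one_le_size _

/-- An entry of the matrix is read off by two list accesses. Outside the range these give `nil`,
which is the binary representation of the default value `0`. -/
theorem RationalMetric.ofBinary_numN {n : ℕ} (M : RationalMetric n) (i j : ℕ) :
    ∃ r : List Data, (List.ofFn fun i => Data.ofList (List.ofFn fun j => .ofBinary (M.num i j))).getD
      i .nil = .ofList r ∧ r.getD j .nil = .ofBinary (M.numN i j) := by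
  by_cases hi : i < n
  · refine ⟨List.ofFn fun j => .ofBinary (M.num ⟨i, hi⟩ j), by
      rw [List.getD_eq_getElem _ _ (by simpa using hi)]; simp, ?_⟩
    by_cases hj : j < n
    · rw [List.getD_eq_getElem _ _ (by simpa using hj)]
      simp [RationalMetric.numN, hi, hj]
    · rw [List.getD_eq_default _ _ (by simpa using hj)]
      simp [RationalMetric.numN, hj, Data.ofBinary, Data.ofList]
  · refine ⟨[], by rw [List.getD_eq_default _ _ (by simpa using hi)]; rfl, ?_⟩
    simp [RationalMetric.numN, hi, Data.ofBinary, Data.ofList]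

theorem Inst.size_numN_le (I : Inst) (i j : ℕ) :
    (Data.ofBinary (I.M.numN i j)).size ≤ I.enc.size := by
  obtain ⟨r, h1, h2⟩ := I.M.ofBinary_numN i j
  rw [← h2]
  refine (Data.size_getD_le _ _).trans ?_
  rw [← h1]
  refine (Data.size_getD_le _ _).trans ?_
  exact Data.size_le_of_mem (by simp)

theorem Inst.size_ofUnary_n_le (I : Inst) : 1 + 2 * I.n ≤ I.enc.size := by
  rw [← Data.size_ofUnary]
  exact Data.size_le_of_mem (by simp)

theorem Inst.foldl_far_lt (I : Inst) (A l : List ℕ) (hl : ∀ x ∈ l, x < I.n) :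
    l.foldl (fun y x => if I.mdist A y ≤ I.mdist A x then x else y) 0 < I.n := by
  induction l using List.reverseRecOn with
  | nil => exact I.n_pos
  | append_singleton l z ih =>
    rw [List.foldl_append, List.foldl_cons, List.foldl_nil]
    split_ifs
    · exact hl z (by simp)
    · exact ih fun x hx => hl x (by simp [hx])

theorem Inst.far_lt (I : Inst) (A : List ℕ) : I.far A < I.n :=
  I.foldl_far_lt A _ fun _ hx => List.mem_range.1 hx

theorem Inst.greedy_iterate (I : Inst) (i : ℕ) :
    ((fun A => I.far A :: A)^[i] [0]).length = i + 1 ∧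
      ∀ x ∈ (fun A => I.far A :: A)^[i] [0], x < I.n := by
  induction i with
  | zero => simpa using I.n_pos
  | succ i ih =>
    rw [Function.iterate_succ_apply']
    refine ⟨by rw [List.length_cons, ih.1], fun x hx => ?_⟩
    rcases List.mem_cons.1 hx with rfl | hx
    · exact I.far_lt _
    · exact ih.2 x hx

/-- The fold starts with the distance to the point `0`, whence the alternative `a = 0`; it does no
harm for the greedy centres, which contain `0`. -/
theorem Inst.mdist_mem (I : Inst) (A : List ℕ) (x : ℕ) :
    ∃ a, (a ∈ A ∨ a = 0) ∧ I.mdist A x = I.M.numN x a := by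
  induction A using List.reverseRecOn with
  | nil => exact ⟨0, by simp, rfl⟩
  | append_singleton A b ih =>
    obtain ⟨a, ha, h⟩ := ih
    rw [Inst.mdist] at h ⊢
    rw [List.foldl_append, List.foldl_cons, List.foldl_nil, h]
    rcases le_total (I.M.numN x a) (I.M.numN x b) with h' | h'
    · exact ⟨a, by simp only [List.mem_append]; tauto, min_eq_left h'⟩
    · exact ⟨b, by simp, min_eq_right h'⟩

theorem Inst.mdist_le (I : Inst) (A : List ℕ) (x : ℕ) {a : ℕ} (ha : a ∈ A ∨ a = 0) :
    I.mdist A x ≤ I.M.numN x a := by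
  induction A using List.reverseRecOn with
  | nil =>
    obtain rfl : a = 0 := by simpa using ha
    exact le_rfl
  | append_singleton A b ih =>
    rw [Inst.mdist] at ih ⊢
    rw [List.foldl_append, List.foldl_cons, List.foldl_nil]
    simp only [List.mem_append, List.mem_singleton] at ha
    rcases ha with (ha | rfl) | ha
    · exact (min_le_left _ _).trans (ih (.inl ha))
    · exact min_le_right _ _
    · exact (min_le_left _ _).trans (ih (.inr ha))

theorem Data.size_list_ofUnary_le {l : List ℕ} {N : ℕ} (h : ∀ x ∈ l, x < N) :
    (Data.list Data.ofUnary l).size ≤ 1 + l.length * (1 + (1 + 2 * N)) := by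
  have := Data.size_ofList_le (l := l.map Data.ofUnary) (B := 1 + 2 * N) (by
    intro d hd
    obtain ⟨j, hj, rfl⟩ := List.mem_map.1 hd
    have := h j hj
    rw [Data.size_ofUnary]
    omega)
  rwa [List.length_map] at this

/-- The factor is doubled only while it is below `n`, so it stays at most `2 * n`; until it has
reached `n` it doubles in every step. -/
theorem doubleStep_iterate (n Δ i : ℕ) :
    ((doubleStep n)^[i] (1, Δ)).2 = Δ * ((doubleStep n)^[i] (1, Δ)).1 ∧
      (0 < n → ((doubleStep n)^[i] (1, Δ)).1 ≤ 2 * n) ∧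
      (n ≤ ((doubleStep n)^[i] (1, Δ)).1 ∨ 2 ^ i ≤ ((doubleStep n)^[i] (1, Δ)).1) := by
  induction i with
  | zero => simp; omega
  | succ i ih =>
    rw [Function.iterate_succ_apply']
    generalize (doubleStep n)^[i] (1, Δ) = s at ih
    obtain ⟨h1, h2, h3⟩ := ih
    unfold doubleStep
    split_ifs with h
    · refine ⟨by simp only [h1]; ring, fun _ => by simp only; omega, ?_⟩
      simp only [pow_succ]
      omega
    · exact ⟨h1, h2, .inl (by omega)⟩

theorem Data.size_ofBinary_two_mul_le (x : ℕ) :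
    (Data.ofBinary (2 * x)).size ≤ (Data.ofBinary x).size + 2 := by
  rcases Nat.eq_zero_or_pos x with rfl | h
  · simp
  · rw [Data.ofBinary_two_mul h.ne']
    simp only [Data.size]
    omega

theorem size_doubleStep_iterate (n Δ i : ℕ) :
    (Data.ofBinary ((doubleStep n)^[i] (1, Δ)).2).size ≤ (Data.ofBinary Δ).size + 2 * i := by
  induction i with
  | zero => simp
  | succ i ih =>
    rw [Function.iterate_succ_apply']
    generalize (doubleStep n)^[i] (1, Δ) = s at ih
    unfold doubleStep
    split_ifs with h
    · have := Data.size_ofBinary_two_mul_le s.2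
      simp only
      omega
    · omega

theorem Inst.cap_pos (I : Inst) : 0 < I.cap := by
  unfold Inst.cap
  split_ifs with h
  · obtain ⟨h1, -, h3⟩ := doubleStep_iterate I.n I.radius I.n
    rw [h1]
    have := I.n_pos
    have h4 : 0 < 2 ^ I.n := by positivity
    exact Nat.mul_pos h (by omega)
  · exact Nat.one_pos

/-- The metric cut off at the distance `cap`, which becomes the unit of length. -/
def Inst.capped (I : Inst) : RationalMetric I.n where
  num i j := min (I.M.num i j) I.cap
  den := I.cap
  den_pos := I.cap_pos
  num_self i := by simp [I.M.num_self]
  eq_of_num_eq_zero i j h := I.M.eq_of_num_eq_zero i j (by have := I.cap_pos; omega)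
  symm i j := by rw [I.M.symm]
  triangle i j l := by have := I.M.triangle i j l; omega

theorem ofFn_eq_range_map {γ : Type} (n : ℕ) (F : ℕ → γ) :
    List.ofFn (fun i : Fin n => F i) = (List.range n).map F := by
  rw [List.ofFn_eq_map, ← List.map_coe_finRange_eq_range, List.map_map]
  rfl

/-! ### Polynomial-time computability of the ingredients of the reduction -/

namespace PT

variable {α β γ : Type} {e : α → Data} {f : β → Data} {g : γ → Data} {I : α → Inst}

theorem arg : PT (Data.prod e f) fun x => f x.2 := (refl (Data.prod e f)).snd
theorem arg₁ : PT (Data.prod e (Data.prod f g)) fun x => f x.2.1 :=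
  (refl (Data.prod e (Data.prod f g))).snd.fst
theorem arg₂ : PT (Data.prod e (Data.prod f g)) fun x => g x.2.2 :=
  (refl (Data.prod e (Data.prod f g))).snd.snd

theorem inst_n (hI : PT e fun a => (I a).enc) : PT e fun a => .ofUnary (I a).n := hI.fst
theorem inst_k (hI : PT e fun a => (I a).enc) : PT e fun a => .ofUnary (I a).k := hI.snd.fst

theorem numN (hI : PT e fun a => (I a).enc) {i j : α → ℕ} (hi : PT e fun a => .ofUnary (i a))
    (hj : PT e fun a => .ofUnary (j a)) : PT e fun a => .ofBinary ((I a).M.numN (i a) (j a)) := by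
  choose r h1 h2 using fun a => (I a).M.ofBinary_numN (i a) (j a)
  have h3 : PT e fun a => .ofList (r a) :=
    (getD (l := fun a => List.ofFn fun i => Data.ofList (List.ofFn fun j =>
      .ofBinary ((I a).M.num i j))) hI.snd.snd.snd.fst hi).of_eq fun a => (h1 a).symm
  exact (getD h3 hj).of_eq fun a => (h2 a).symm

theorem mdist (hI : PT e fun a => (I a).enc) {A : α → List ℕ} {x : α → ℕ}
    (hA : PT e fun a => Data.list Data.ofUnary (A a)) (hx : PT e fun a => .ofUnary (x a)) :
    PT e fun a => .ofBinary ((I a).mdist (A a) (x a)) :=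
  foldl (eb := Data.ofBinary) (ec := Data.ofUnary) (init := fun a => (I a).M.numN (x a) 0)
    (s := fun a m b => min m ((I a).M.numN (x a) b)) (numN hI hx (const (.ofUnary 0))) hA
    (bmin arg₁ (numN hI.left hx.left arg₂))
    (hI.size.sup fun a i _ => by
      obtain ⟨b, -, hb⟩ := (I a).mdist_mem ((A a).take i) (x a)
      rw [Inst.mdist] at hb
      rw [hb]
      exact (I a).size_numN_le _ _)

theorem far (hI : PT e fun a => (I a).enc) {A : α → List ℕ}
    (hA : PT e fun a => Data.list Data.ofUnary (A a)) :
    PT e fun a => .ofUnary ((I a).far (A a)) := by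
  refine (foldl (eb := Data.ofUnary) (ec := Data.ofUnary) (init := fun _ => 0)
    (l := fun a => List.range (I a).n)
    (s := fun a y x => if (I a).mdist (A a) y ≤ (I a).mdist (A a) x then x else y) nil
    (range (inst_n hI))
    ((cond (ble (mdist hI.left hA.left arg₁) (mdist hI.left hA.left arg₂)) arg₂ arg₁).of_eq
      fun x => ?_)
    (hI.size.sup fun a i _ => ?_))
  · simp only [decide_eq_true_eq]
    split_ifs <;> rfl
  · have h1 := (I a).size_ofUnary_n_le
    have h2 := (I a).foldl_far_lt (A a) ((List.range (I a).n).take i) fun x hx =>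
      List.mem_range.1 (List.mem_of_mem_take hx)
    rw [Data.size_ofUnary]
    omega

theorem greedy (hI : PT e fun a => (I a).enc) :
    PT e fun a => Data.list Data.ofUnary (I a).greedy := by
  have hn := (inst_n hI).unary_le
  have hk := (inst_k hI).unary_le
  have one := PolyBounded.const (fun a => (e a).size) 1
  refine iterate (eb := Data.list Data.ofUnary) (init := fun _ => [0])
    (s := fun a A => (I a).far A :: A) (pred (inst_k hI)) (const (Data.list Data.ofUnary [0]))
    ((far hI.left arg).pair arg)
    (b := fun a => 1 + ((I a).k + 1) * (1 + (1 + 2 * (I a).n)))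
    (one.add ((hk.add one).mul (one.add (one.add ((PolyBounded.const _ 2).mul hn)))))
    fun a i hi => ?_
  obtain ⟨h1, h2⟩ := (I a).greedy_iterate i
  refine (Data.size_list_ofUnary_le h2).trans ?_
  rw [h1]
  gcongr
  omega

theorem radius (hI : PT e fun a => (I a).enc) : PT e fun a => .ofBinary (I a).radius :=
  mdist hI (greedy hI) (far hI (greedy hI))

theorem cap (hI : PT e fun a => (I a).enc) : PT e fun a => .ofBinary (I a).cap := by
  have hn := (inst_n hI).unary_le
  have one := PolyBounded.const (fun a => (e a).size) 1
  have two := PolyBounded.const (fun a => (e a).size) 2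
  have := iterate (e := e) (eb := Data.prod Data.ofUnary Data.ofBinary)
    (init := fun a => (1, (I a).radius)) (s := fun a => doubleStep (I a).n) (inst_n hI)
    ((const (.ofUnary 1)).pair (radius hI))
    ((cond (lt arg₁ (inst_n hI.left)) ((mul (const (.ofUnary 2)) arg₁).pair (bdouble arg₂))
      arg).of_eq fun x => by
        simp only [decide_eq_true_eq, doubleStep]
        split_ifs <;> rfl)
    (b := fun a => 1 + (1 + 2 * (2 * (I a).n)) + ((Data.ofBinary (I a).radius).size + 2 * (I a).n))
    ((one.add (one.add (two.mul (two.mul hn)))).add ((radius hI).size.add (two.mul hn)))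
    fun a i hi => by
      have h1 := (doubleStep_iterate (I a).n (I a).radius i).2.1 (I a).n_pos
      have h2 := size_doubleStep_iterate (I a).n (I a).radius i
      simp only [Data.size, Data.size_ofUnary]
      omega
  refine (cond (bpos (radius hI)) this.snd (const (.ofBinary 1))).of_eq fun a => ?_
  simp only [decide_eq_true_eq, Inst.cap]
  split_ifs <;> rfl

theorem capped (hI : PT e fun a => (I a).enc) :
    PT e fun a => (I a).capped.encode (I a).k := by
  have hrow := map (ec := Data.ofUnary) (eb := Data.ofBinary)
    (h := fun (x : α × ℕ) j => min ((I x.1).M.numN x.2 j) (I x.1).cap) (range (inst_n hI.left))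
    (bmin (numN hI.left.left (left (e := Data.prod e Data.ofUnary) arg) arg) (cap hI.left.left))
  have hmat := map (ec := Data.ofUnary) (eb := Data.list Data.ofBinary)
    (h := fun a i => (List.range (I a).n).map fun j => min ((I a).M.numN i j) (I a).cap)
    (range (inst_n hI)) hrow
  refine ((inst_n hI).pair ((inst_k hI).pair ((cap hI).pair (hmat.pair nil)))).of_eq fun a => ?_
  have h1 : (List.ofFn fun i => .ofList (List.ofFn fun j => .ofBinary ((I a).capped.num i j))) =
      (List.range (I a).n).map fun i => Data.ofList ((List.range (I a).n).map fun j =>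
        .ofBinary (min ((I a).M.numN i j) (I a).cap)) := by
    rw [← ofFn_eq_range_map]
    congr 1
    funext i
    rw [← ofFn_eq_range_map]
    congr 2
    funext j
    rw [RationalMetric.numN_fin]
    rfl
  rw [RationalMetric.encode, h1]
  simp only [Data.ofList, Data.list, List.map_map, Function.comp_def]
  rfl

theorem select (hI : PT e fun a => (I a).enc) {C : α → List ℕ}
    (hC : PT e fun a => Data.list Data.ofUnary (C a)) :
    PT e fun a => Data.list Data.ofUnary ((I a).select (C a)) := by
  have h1 := all (p := fun (x : α × ℕ) b => decide ((I x.1).cap ≤ (I x.1).M.numN x.2 b))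
    (hC.left (f := Data.ofUnary))
    (ble (cap hI.left.left) (numN hI.left.left (left (e := Data.prod e Data.ofUnary) arg) arg))
  have h2 := any (p := fun a y => (C a).all fun b => decide ((I a).cap ≤ (I a).M.numN y b))
    (range (inst_n hI)) h1
  refine (cond h2 (greedy hI) hC).of_eq fun a => ?_
  rw [Inst.select]
  split_ifs <;> rfl

theorem getElemD {ec : γ → Data} {c : γ} (hc : ec c = .nil) {l : α → List γ} {m : α → ℕ}
    (hl : PT e fun a => Data.list ec (l a)) (hm : PT e fun a => .ofUnary (m a)) :
    PT e fun a => ec ((l a).getD (m a) c) :=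
  (getD hl hm).of_eq fun a => by rw [← hc, List.getD_map]

/-- The entries are looked up by their indices below `m a`; by `h` the default value `0` of the
lookup is never used. -/
theorem take {l : α → List ℕ} {m : α → ℕ} (hl : PT e fun a => Data.list Data.ofUnary (l a))
    (hm : PT e fun a => .ofUnary (m a)) (h : ∀ a, m a ≤ (l a).length) :
    PT e fun a => Data.list Data.ofUnary ((l a).take (m a)) := by
  refine (map (eb := Data.ofUnary) (h := fun a i => (l a).getD i 0) (range hm)
    (getElemD rfl hl.left arg)).of_eq fun a => ?_
  congr 1
  refine List.ext_getElem (by simp [h a]) fun i h1 h2 => ?_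
  simp only [List.length_take] at h1
  simp [List.getElem?_eq_getElem (show i < (l a).length by omega)]

theorem fill (hI : PT e fun a => (I a).enc) {C : α → List ℕ}
    (hC : PT e fun a => Data.list Data.ofUnary (C a)) :
    PT e fun a => Data.list Data.ofUnary ((I a).fill (C a)) := by
  have h1 := any (p := fun (x : α × ℕ) b => decide (b = x.2))
    (hC.left (f := Data.ofUnary)) (eq arg (left (e := Data.prod e Data.ofUnary) arg))
  refine take (append (filter (range (inst_n hI)) h1) (filter (range (inst_n hI)) (not h1)))
    (inst_k hI) fun a => ?_
  have := (List.range (I a).n).length_eq_length_filter_add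
    (fun x => (C a).any fun b => decide (b = x))
  rw [List.length_append, ← this, List.length_range]
  exact (I a).le_n

theorem segment {l : α → List Bool} {i L : α → ℕ} (hl : PT e fun a => Data.list Data.ofBool (l a))
    (hi : PT e fun a => .ofUnary (i a)) (hL : PT e fun a => .ofUnary (L a)) :
    PT e fun a => Data.list Data.ofBool (segment (l a) (i a) (L a)) :=
  map (h := fun a j => (l a).getD (i a + j) false) (range hL)
    (getElemD rfl hl.left (add hi.left arg))

theorem sample {l : α → List Bool} {N : α → ℕ} (hl : PT e fun a => Data.list Data.ofBool (l a))
    (hN : PT e fun a => .ofUnary (N a)) (h : ∀ a, 0 < N a) :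
    PT e fun a => .ofUnary (sample (N a) (l a)) := by
  refine foldl (eb := Data.ofUnary) (init := fun _ => 0)
    (s := fun a v b => (2 * v + b.toNat) % N a) nil hl
    (mod (add (mul (const (.ofUnary 2)) arg₁) ?_) hN.left) (hN.size.sup fun a i _ => ?_)
  · refine (cond (b := fun x : α × ℕ × Bool => x.2.2) arg₂ (const (.ofUnary 1))
      (const (.ofUnary 0))).of_eq fun x => ?_
    cases x.2.2 <;> rfl
  · have := sample_lt (h a) ((l a).take i)
    rw [KServer.sample] at this
    rw [Data.size_ofUnary, Data.size_ofUnary]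
    omega

end PT

namespace PT

variable {α : Type} {e : α → Data}

/-- The online algorithm must be handed exactly as many bits as its polynomial prescribes at the
size of the capped instance and the horizon, so the reduction has to compute this size. -/
theorem inputSize {n k : α → ℕ} {M : ∀ a, RationalMetric (n a)}
    (h : PT e fun a => (M a).encode (k a)) : PT e fun a => .ofUnary ((M a).inputSize (k a)) := by
  have h1 : PT e fun a => Data.list (Data.list Data.ofBinary)
      (List.ofFn fun i => List.ofFn fun j => (M a).num i j) :=
    h.snd.snd.snd.fst.of_eq fun a => by
      simp only [Data.list, List.map_ofFn, Function.comp_def]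
      rfl
  have h2 := sizeList h1 (sizeList arg (sizeBinary arg))
  have h3 : PT e fun a => .ofUnary (Data.ofBinary (M a).den).size := sizeBinary h.snd.snd.fst
  have h4 : PT e fun a => .ofUnary (n a) := h.fst
  have h5 : PT e fun a => .ofUnary (k a) := h.snd.fst
  -- The constant counts four pairs, the end of the list of four entries, and the ends of the two
  -- unary numbers.
  refine (add (add (const (.ofUnary 7)) (add (mul (const (.ofUnary 2)) h4)
    (mul (const (.ofUnary 2)) h5))) (add h3 h2)).of_eq fun a => ?_
  rw [RationalMetric.inputSize, RationalMetric.encode]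
  simp only [Data.ofList, Data.size, Data.size_ofUnary, Data.list, List.map_ofFn,
    Function.comp_def]
  congr 1
  omega

end PT

/-! ### The `k`-median algorithm -/

namespace KServerAlgorithm

variable (A : KServerAlgorithm) (p : Polynomial ℕ) (c : ℕ) (I : Inst) (l : List Bool)

/-- One less than the time horizon. -/
def _root_.KServer.Inst.rounds : ℕ := p.eval I.n + 1

/-- The number of random bits used by the online algorithm. -/
def serverCoins : ℕ := A.coins.eval (I.capped.inputSize I.k + (I.rounds p + 1))

/-- The number of random bits used for the choice of a round. -/
def _root_.KServer.Inst.stopCoins : ℕ := I.rounds p + c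

/-- The number of random bits used for a single request. -/
def _root_.KServer.Inst.requestCoins : ℕ := I.n + c

/-- The random request in round `t`. -/
def _root_.KServer.Inst.request (t : ℕ) : Fin I.n :=
  ⟨sample I.n (segment l (t * I.requestCoins c) (I.requestCoins c)), sample_lt I.n_pos _⟩

/-- The random round whose configuration is used. -/
def _root_.KServer.Inst.stopRound : ℕ := sample (I.rounds p) (segment l 0 (I.stopCoins p c))

/-- The configuration of the online algorithm in round `t`. -/
def answer (w v : List Bool) (t : ℕ) : Fin I.k → Fin I.n :=
  A.configAt I.capped I.k (I.rounds p + 1)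
    (fun i : Fin (A.serverCoins p I) => w.getD i false) (I.request c v) t

/-- The solution of the `k`-median problem. -/
def centres : List ℕ :=
  I.fill (I.select (List.ofFn fun i => (A.answer p c I
    (l.drop (I.stopCoins p c + (I.rounds p + 1) * I.requestCoins c))
    (l.drop (I.stopCoins p c)) (I.stopRound p c l) i : ℕ)))

end KServerAlgorithm

theorem Data.ofPoints_eq {n : ℕ} (l : List (Fin n)) :
    Data.ofPoints l = Data.list (fun i : Fin n => Data.ofUnary i) l := by
  -- In `Data.ofPoints` the list of points is first coerced to a list of natural numbers, and this
  -- coercion is a monadic bind.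
  have : (do let a ← l; pure (a : ℕ)) = l.map fun i : Fin n => (i : ℕ) := by
    simp [List.map_eq_flatMap]
  rw [Data.ofPoints, this, List.map_map]
  rfl

theorem getD_drop {γ : Type} (l : List γ) (i j : ℕ) (x : γ) :
    (l.drop i).getD j x = l.getD (i + j) x := by
  simp [List.getD_eq_getElem?_getD]

theorem segment_drop (l : List Bool) (i j L : ℕ) :
    segment (l.drop i) j L = segment l (i + j) L := by
  simp only [segment, getD_drop, add_assoc]

theorem Inst.stopRound_lt (p : Polynomial ℕ) (c : ℕ) (I : Inst) (l : List Bool) :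
    I.stopRound p c l < I.rounds p := sample_lt (Nat.succ_pos _) _

theorem Inst.capped_distLeOne (I : Inst) : I.capped.DistLeOne := by
  intro i j
  simp only [RationalMetric.dist, Inst.capped]
  rw [div_le_one (by exact_mod_cast I.cap_pos)]
  exact_mod_cast min_le_right _ _

/-- The random string is cut into bits for the stopping round, for the requests, and for the online
algorithm. A single call of `A.prog`, on the requests up to the stopping round, suffices: its answer
depends only on the instance, the horizon, these requests and the bits. -/
theorem PT.centres (A : KServerAlgorithm) (p : Polynomial ℕ) (c : ℕ) :
    PT (Data.prod Inst.enc (Data.list Data.ofBool))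
      fun x => Data.list Data.ofUnary (A.centres p c x.1 x.2) := by
  set e := Data.prod Inst.enc (Data.list Data.ofBool) with he
  have hI : PT e fun x => x.1.enc := (PT.refl e).fst
  have hl : PT e fun x => Data.list Data.ofBool x.2 := PT.arg
  have hn := inst_n hI
  have hS : PT e fun x => .ofUnary (x.1.rounds p) := succ (polynomial hn p)
  have hL : PT e fun x => .ofUnary (x.1.requestCoins c) := add hn (const (.ofUnary c))
  have hL' : PT e fun x => .ofUnary (x.1.stopCoins p c) := add hS (const (.ofUnary c))
  have hM := capped hI
  have hA : PT e fun x => .ofUnary (A.serverCoins p x.1) :=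
    polynomial (add (inputSize hM) (succ hS)) A.coins
  have hround : PT e fun x => .ofUnary (x.1.stopRound p c x.2) :=
    sample (segment hl (const (.ofUnary 0)) hL') hS fun _ => Nat.succ_pos _
  have hr : PT e fun x => Data.ofBits fun i : Fin (A.serverCoins p x.1) =>
      (x.2.drop (x.1.stopCoins p c + (x.1.rounds p + 1) * x.1.requestCoins c)).getD i false := by
    refine (segment hl (add hL' (mul (succ hS) hL)) hA).of_eq fun x => ?_
    rw [Data.ofBits, Data.list, KServer.segment, List.map_map, ← ofFn_eq_range_map]
    simp only [getD_drop, Function.comp]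
  have hpast : PT e fun x => Data.ofPoints ((List.range (x.1.stopRound p c x.2 + 1)).map
      (x.1.request c (x.2.drop (x.1.stopCoins p c)))) := by
    refine (map (eb := Data.ofUnary) (h := fun (x : Inst × List Bool) t => KServer.sample x.1.n
      (KServer.segment x.2 (x.1.stopCoins p c + t * x.1.requestCoins c) (x.1.requestCoins c)))
      (range (succ hround)) (sample (segment hl.left (add hL'.left (mul arg hL.left)) hL.left)
        hn.left fun x => x.1.1.n_pos)).of_eq fun x => ?_
    simp only [Data.ofPoints_eq, Data.list, List.map_map, Function.comp_def, Inst.request,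
      segment_drop]
  have hin : PT e fun x => serverInput x.1.capped x.1.k (x.1.rounds p + 1)
      ((List.range (x.1.stopRound p c x.2 + 1)).map (x.1.request c (x.2.drop (x.1.stopCoins p c))))
      fun i : Fin (A.serverCoins p x.1) =>
      (x.2.drop (x.1.stopCoins p c + (x.1.rounds p + 1) * x.1.requestCoins c)).getD i false :=
    hM.pair ((succ hS).pair (hpast.pair (hr.pair nil)))
  have hout : PT e fun x => Data.list Data.ofUnary (List.ofFn fun i => (A.answer p c x.1
      (x.2.drop (x.1.stopCoins p c + (x.1.rounds p + 1) * x.1.requestCoins c))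
      (x.2.drop (x.1.stopCoins p c)) (x.1.stopRound p c x.2) i : ℕ)) := by
    refine hin.trans ((of_outputs A.prog
      (fun x => A.time.eval (x.1.capped.inputSize x.1.k + (x.1.rounds p + 1))) ?_
      fun x => A.computes x.1.capped x.1.k (x.1.rounds p + 1) x.1.capped_distLeOne x.1.one_le
        x.1.le_n _ _ ?_ ?_).of_eq fun x => ?_)
    · refine ((PolyBounded.self _).mono fun x => ?_).eval A.time
      simp only [serverInput, Data.ofList, Data.size, RationalMetric.inputSize, Data.size_ofUnary]
      omega
    · simp
    · have := x.1.stopRound_lt p c x.2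
      simp only [List.length_map, List.length_range]
      omega
    · simp only [Data.list, Data.ofPoints_eq, List.map_ofFn, Function.comp_def]
      rfl
  exact fill hI (select hI hout)

/-! ### Properties of the greedy centres and of the cut-off metric -/

namespace Inst

variable (I : Inst)

/-- After `n` doubling steps the factor is at least `n`, because `n < 2 ^ n`. -/
theorem radius_mul_le_cap : I.n * I.radius ≤ I.cap := by
  rcases Nat.eq_zero_or_pos I.radius with h | h
  · rw [h, mul_zero]
    exact Nat.zero_le _
  · obtain ⟨h1, -, h3⟩ := doubleStep_iterate I.n I.radius I.n
    rw [cap, if_pos h, h1, mul_comm]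
    have := I.n.lt_two_pow_self
    exact Nat.mul_le_mul_left _ (by omega)

theorem cap_le (h : 0 < I.radius) : I.cap ≤ 2 * I.n * I.radius := by
  obtain ⟨h1, h2, -⟩ := doubleStep_iterate I.n I.radius I.n
  rw [cap, if_pos h, h1, mul_comm]
  exact Nat.mul_le_mul_right _ (h2 I.n_pos)

theorem mdist_le_far (A : List ℕ) {x : ℕ} (hx : x < I.n) :
    I.mdist A x ≤ I.mdist A (I.far A) := by
  have : ∀ l : List ℕ, ∀ x ∈ l, I.mdist A x ≤
      I.mdist A (l.foldl (fun y x => if I.mdist A y ≤ I.mdist A x then x else y) 0) := by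
    intro l
    induction l using List.reverseRecOn with
    | nil => simp
    | append_singleton l z ih =>
      intro x hx
      rw [List.foldl_append, List.foldl_cons, List.foldl_nil]
      simp only [List.mem_append, List.mem_singleton] at hx
      split_ifs with h
      · rcases hx with hx | rfl
        · exact (ih x hx).trans h
        · exact le_rfl
      · rcases hx with hx | rfl
        · exact ih x hx
        · exact (not_le.1 h).le
  exact this _ x (List.mem_range.2 hx)

theorem mdist_cons_le (A : List ℕ) (b x : ℕ) : I.mdist (b :: A) x ≤ I.mdist A x := by
  obtain ⟨a, ha, h⟩ := I.mdist_mem A x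
  rw [h]
  exact I.mdist_le _ _ (by simp only [List.mem_cons]; tauto)

theorem pairwise_far (A : List ℕ)
    (h : A.Pairwise fun a b => I.mdist A (I.far A) ≤ I.M.numN a b) :
    (I.far A :: A).Pairwise fun a b => I.mdist A (I.far A) ≤ I.M.numN a b :=
  List.pairwise_cons.2 ⟨fun _ hb => I.mdist_le _ _ (.inl hb), h⟩

/-- Each centre is as far from the earlier ones as the farthest point was at that time. This
distance can only shrink as centres are added, so all mutual distances are at least its last value,
the radius. -/
theorem pairwise_greedy :
    (I.far I.greedy :: I.greedy).Pairwise fun a b => I.radius ≤ I.M.numN a b := by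
  refine I.pairwise_far _ ?_
  rw [greedy]
  induction I.k - 1 with
  | zero => simp
  | succ i ih =>
    rw [Function.iterate_succ_apply']
    refine (I.pairwise_far _ ih).imp fun {a b} hab => le_trans ?_ hab
    exact (I.mdist_cons_le _ _ _).trans (I.mdist_le_far _ (I.far_lt _))

theorem length_greedy : I.greedy.length = I.k := by
  rw [greedy, (I.greedy_iterate _).1]
  have := I.one_le
  omega

theorem greedy_lt {x : ℕ} (hx : x ∈ I.greedy) : x < I.n := (I.greedy_iterate _).2 x hx

theorem zero_mem_greedy : 0 ∈ I.greedy := by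
  rw [greedy]
  induction I.k - 1 with
  | zero => simp
  | succ i ih =>
    rw [Function.iterate_succ_apply']
    exact List.mem_cons_of_mem _ ih

/-- Pigeonhole: if every point had a server closer than half the radius, two of the `k + 1` points
in `pairwise_greedy` would share one, and the triangle inequality would put them closer than the
radius. -/
theorem exists_far_point (C : Fin I.k → Fin I.n) :
    ∃ x, ∀ i, I.radius ≤ 2 * I.M.num x (C i) := by
  by_contra! h
  choose c hc using h
  set G := I.far I.greedy :: I.greedy with hG
  have hlen : G.length = I.k + 1 := by rw [hG, List.length_cons, I.length_greedy]
  have hlt : ∀ x ∈ G, x < I.n := by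
    intro x hx
    rcases List.mem_cons.1 hx with rfl | hx
    · exact I.far_lt _
    · exact I.greedy_lt hx
  obtain ⟨i, j, hij, hc'⟩ := Fintype.exists_ne_map_eq_of_card_lt
    (fun i : Fin G.length => c ⟨G[i], hlt _ (List.getElem_mem _)⟩) (by simp [hlen])
  wlog hlt' : i < j generalizing i j
  · exact this j i hij.symm hc'.symm (lt_of_le_of_ne (not_lt.1 hlt') hij.symm)
  have h1 := List.pairwise_iff_getElem.1 I.pairwise_greedy i j i.2 j.2 hlt'
  set x : Fin I.n := ⟨G[i], hlt _ (List.getElem_mem _)⟩ with hx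
  set y : Fin I.n := ⟨G[j], hlt _ (List.getElem_mem _)⟩ with hy
  have h2 : I.radius ≤ I.M.num x y := by
    rw [← RationalMetric.numN_fin]
    exact h1
  have h3 := I.M.triangle x (C (c x)) y
  have h4 := hc x
  have h5 := hc y
  rw [I.M.symm (C (c x)) y, show c x = c y from hc'] at h3
  rw [show c x = c y from hc'] at h4
  omega

/-- With radius zero every point coincides with a greedy centre, and there are only `k` of these. -/
theorem k_eq_n (h : I.radius = 0) : I.k = I.n := by
  refine le_antisymm I.le_n ?_
  have hsub : List.range I.n ⊆ I.greedy := by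
    intro x hx
    have hx := List.mem_range.1 hx
    have h1 := I.mdist_le_far I.greedy hx
    rw [show I.mdist I.greedy (I.far I.greedy) = 0 from h] at h1
    obtain ⟨a, ha, h2⟩ := I.mdist_mem I.greedy x
    have ha : a ∈ I.greedy := by
      rcases ha with ha | rfl
      · exact ha
      · exact I.zero_mem_greedy
    have han := I.greedy_lt ha
    have h3 : I.M.num ⟨x, hx⟩ ⟨a, han⟩ = 0 := by
      rw [← RationalMetric.numN_fin]
      simp only
      omega
    have := I.M.eq_of_num_eq_zero _ _ h3
    simp only [Fin.mk.injEq] at this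
    rwa [this]
  have := (List.nodup_range.subperm hsub).length_le
  rwa [List.length_range, I.length_greedy] at this

/-- The points of `C` come first in the list and number at most `k`, so the truncation to `k`
entries loses none of them. -/
theorem fill_spec (C : List ℕ) (hC : C.length ≤ I.k) (hlt : ∀ x ∈ C, x < I.n) :
    (I.fill C).Nodup ∧ (I.fill C).length = I.k ∧ (∀ x ∈ I.fill C, x < I.n) ∧ C ⊆ I.fill C := by
  set P : ℕ → Bool := fun x => C.any fun a => decide (a = x) with hP
  have hfill : I.fill C = ((List.range I.n).filter P ++
      (List.range I.n).filter fun x => !P x).take I.k := rfl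
  have hmem : ∀ x, P x = true ↔ x ∈ C := by
    intro x
    simp [hP]
  have hnodup : ((List.range I.n).filter P ++ (List.range I.n).filter fun x => !P x).Nodup := by
    refine (List.nodup_range.filter _).append (List.nodup_range.filter _) ?_
    intro x hx hx'
    have h1 := (List.mem_filter.1 hx).2
    have h2 := (List.mem_filter.1 hx').2
    simp [h1] at h2
  have hlen := (List.range I.n).length_eq_length_filter_add P
  rw [List.length_range, ← List.length_append] at hlen
  refine ⟨?_, ?_, ?_, ?_⟩
  · rw [hfill]
    exact hnodup.sublist (List.take_sublist _ _)
  · rw [hfill, List.length_take, ← hlen]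
    exact min_eq_left I.le_n
  · intro x hx
    have := List.mem_of_mem_take hx
    simp only [List.mem_append, List.mem_filter, List.mem_range] at this
    rcases this with h | h <;> exact h.1
  · intro x hx
    have h1 : ((List.range I.n).filter P).length ≤ I.k := by
      refine (((List.nodup_range.filter P).subperm ?_).length_le).trans hC
      intro y hy
      exact (hmem y).1 (List.mem_filter.1 hy).2
    rw [hfill, List.take_append, List.take_of_length_le h1]
    exact List.mem_append_left _ (List.mem_filter.2 ⟨List.mem_range.2 (hlt x hx), (hmem x).2 hx⟩)

end Inst

/-! ### Costs of configurations -/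

variable {n k : ℕ}

/-- The distance of a point to a configuration. -/
def configDist (M : RationalMetric n) (x : Fin n) (C : Fin k → Fin n) : ℝ := ⨅ i, M.dist x (C i)

/-- The sum of the distances of all points to a configuration. -/
def configVal (M : RationalMetric n) (C : Fin k → Fin n) : ℝ := ∑ x, configDist M x C

theorem RationalMetric.dist_nonneg (M : RationalMetric n) (x y : Fin n) : 0 ≤ M.dist x y :=
  div_nonneg (Nat.cast_nonneg _) (Nat.cast_nonneg _)

theorem RationalMetric.dist_symm (M : RationalMetric n) (x y : Fin n) :
    M.dist x y = M.dist y x := by rw [RationalMetric.dist, M.symm, ← RationalMetric.dist]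

theorem RationalMetric.dist_triangle (M : RationalMetric n) (x y z : Fin n) :
    M.dist x z ≤ M.dist x y + M.dist y z := by
  simp only [RationalMetric.dist, ← add_div]
  gcongr
  exact_mod_cast M.triangle x y z

theorem configDist_nonneg (M : RationalMetric n) (x : Fin n) (C : Fin k → Fin n) :
    0 ≤ configDist M x C := Real.iInf_nonneg fun _ => M.dist_nonneg _ _

theorem configDist_le (M : RationalMetric n) (x : Fin n) (C : Fin k → Fin n) (i : Fin k) :
    configDist M x C ≤ M.dist x (C i) := ciInf_le (Set.finite_range _).bddBelow i

theorem exists_configDist_eq (hk : 1 ≤ k) (M : RationalMetric n) (x : Fin n) (C : Fin k → Fin n) :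
    ∃ i, configDist M x C = M.dist x (C i) := by
  have : Nonempty (Fin k) := ⟨⟨0, hk⟩⟩
  obtain ⟨i, hi⟩ := exists_eq_ciInf_of_finite (f := fun i => M.dist x (C i))
  exact ⟨i, hi.symm⟩

/-- The case of a server at `x` is no exception, since the distance is zero there. -/
theorem serverLoss_eq (M : RationalMetric n) (x : Fin n) (C : Fin k → Fin n) :
    serverLoss M x C = 2 * configDist M x C := by
  rw [serverLoss, configDist]
  split_ifs with h
  · obtain ⟨i, rfl⟩ := h
    have h1 := configDist_nonneg M (C i) C
    have h2 := configDist_le M (C i) C i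
    rw [RationalMetric.dist, M.num_self, Nat.cast_zero, zero_div] at h2
    rw [configDist] at h1 h2
    linarith
  · simp only [M.dist_symm x]

/-- From `x` go to the nearest server of `C` and then along the edge of an optimal matching. The
factor 2 in the loss is not needed here. -/
theorem configDist_le_serverLoss_add (hk : 1 ≤ k) (M : RationalMetric n) (x : Fin n)
    (C C' : Fin k → Fin n) : configDist M x C' ≤ serverLoss M x C + matchDist M C C' := by
  obtain ⟨i, hi⟩ := exists_configDist_eq hk M x C
  obtain ⟨σ, hσ⟩ := exists_eq_ciInf_of_finite
    (f := fun σ : Equiv.Perm (Fin k) => ∑ i, M.dist (C i) (C' (σ i)))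
  rw [serverLoss_eq, matchDist, ← hσ, hi]
  have h1 := configDist_le M x C' (σ i)
  have h2 := M.dist_triangle x (C i) (C' (σ i))
  have h3 := M.dist_nonneg x (C i)
  have h4 : M.dist (C i) (C' (σ i)) ≤ ∑ i, M.dist (C i) (C' (σ i)) :=
    Finset.single_le_sum (f := fun i => M.dist (C i) (C' (σ i)))
      (fun _ _ => M.dist_nonneg _ _) (Finset.mem_univ i)
  linarith

/-- The central inequality: each configuration is judged by the next request, which it cannot
anticipate, and the price of reacting to that request is already contained in the cost. Round `0`
contributes a nonnegative loss that is dropped. -/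
theorem sum_configDist_le_serverCost (hk : 1 ≤ k) (M : RationalMetric n) (S : ℕ) (x : ℕ → Fin n)
    (C : ℕ → Fin k → Fin n) :
    ∑ t ∈ Finset.range S, configDist M (x (t + 1)) (C t) ≤ serverCost M (S + 1) x C := by
  rw [serverCost, Finset.sum_range_succ', Finset.sum_Ico_eq_sum_range, Nat.add_sub_cancel]
  have h1 : ∑ t ∈ Finset.range S, configDist M (x (t + 1)) (C t) ≤
      ∑ t ∈ Finset.range S, (serverLoss M (x (t + 1)) (C (t + 1)) +
        matchDist M (C (1 + t)) (C (1 + t - 1))) := by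
    refine Finset.sum_le_sum fun t _ => ?_
    rw [Nat.add_sub_cancel_left, add_comm 1 t]
    exact configDist_le_serverLoss_add hk M _ _ _
  rw [Finset.sum_add_distrib] at h1
  have h2 : 0 ≤ serverLoss M (x 0) (C 0) := by
    rw [serverLoss_eq]
    exact mul_nonneg zero_le_two (configDist_nonneg _ _ _)
  linarith

theorem bestStaticCost_le (M : RationalMetric n) (T : ℕ) (x : ℕ → Fin n) (C : Fin k → Fin n) :
    bestStaticCost M k T x ≤ ∑ t ∈ Finset.range T, 2 * configDist M (x t) C := by
  refine (ciInf_le (Set.finite_range _).bddBelow C).trans_eq ?_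
  simp only [serverLoss_eq]

namespace Inst

variable (I : Inst)

theorem capped_dist (x y : Fin I.n) :
    I.capped.dist x y = min (I.M.num x y : ℝ) I.cap / I.cap := by
  simp [RationalMetric.dist, capped]

theorem cap_pos' : (0 : ℝ) < I.cap := by exact_mod_cast I.cap_pos

theorem den_pos' : (0 : ℝ) < I.M.den := by exact_mod_cast I.M.den_pos

/-- The set of points in a list. -/
def points (l : List ℕ) : Finset (Fin I.n) := Finset.univ.filter fun x => (x : ℕ) ∈ l

theorem iInf_points_le {l : List ℕ} (x a : Fin I.n) (ha : (a : ℕ) ∈ l) :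
    ⨅ a : I.points l, I.M.dist x a ≤ I.M.num x a / I.M.den :=
  ciInf_le (f := fun a : I.points l => I.M.dist x a) (Set.finite_range _).bddBelow
    ⟨a, by simpa [points]⟩

/-- If `select` falls back on the greedy centres, some point has capped distance one from `C`, and
`cap` is at least `n` times the radius, which bounds the numerator of the greedy value. Otherwise
every point has a centre closer than `cap`, and the capped distance to a nearest centre is the true
one. Additional centres only help. -/
theorem medianVal_fill_le (C : Fin I.k → Fin I.n) :
    medianVal I.M (I.points (I.fill (I.select (List.ofFn fun i => (C i : ℕ))))) ≤
      I.cap / I.M.den * configVal I.capped C := by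
  have hcap := I.cap_pos'
  have hden := I.den_pos'
  set L := List.ofFn fun i => (C i : ℕ) with hL
  by_cases h : ((List.range I.n).any fun x =>
      L.all fun a => decide (I.cap ≤ I.M.numN x a)) = true
  · rw [select, if_pos h]
    obtain ⟨-, -, -, hsub⟩ := I.fill_spec I.greedy I.length_greedy.le fun x hx => I.greedy_lt hx
    have h1 : medianVal I.M (I.points (I.fill I.greedy)) ≤
        ∑ _x : Fin I.n, (I.radius : ℝ) / I.M.den := by
      refine Finset.sum_le_sum fun x _ => ?_
      obtain ⟨a, ha, hd⟩ := I.mdist_mem I.greedy x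
      have ha : a ∈ I.greedy := by
        rcases ha with ha | rfl
        · exact ha
        · exact I.zero_mem_greedy
      refine (I.iInf_points_le x ⟨a, I.greedy_lt ha⟩ (hsub ha)).trans ?_
      gcongr
      rw [← RationalMetric.numN_fin]
      simp only
      rw [← hd]
      exact I.mdist_le_far _ x.2
    rw [Finset.sum_const, Finset.card_univ, Fintype.card_fin, nsmul_eq_mul] at h1
    simp only [List.any_eq_true, List.all_eq_true, List.mem_range, decide_eq_true_eq] at h
    obtain ⟨x, hx, hfar⟩ := h
    have h2 : 1 ≤ configVal I.capped C := by
      obtain ⟨i, hi⟩ := exists_configDist_eq I.one_le I.capped ⟨x, hx⟩ C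
      refine le_trans ?_ (Finset.single_le_sum (f := fun x => configDist I.capped x C)
        (fun _ _ => configDist_nonneg _ _ _) (Finset.mem_univ ⟨x, hx⟩))
      rw [hi, capped_dist, min_eq_right, div_self hcap.ne']
      have := hfar (C i) (by rw [hL]; simp)
      rw [show x = ((⟨x, hx⟩ : Fin I.n) : ℕ) from rfl, RationalMetric.numN_fin] at this
      exact_mod_cast this
    have h3 : (I.n : ℝ) * I.radius ≤ I.cap := by exact_mod_cast I.radius_mul_le_cap
    calc _ ≤ (I.n : ℝ) * (I.radius / I.M.den) := h1
      _ = I.n * I.radius / I.M.den := by ring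
      _ ≤ I.cap / I.M.den := by gcongr
      _ = I.cap / I.M.den * 1 := by ring
      _ ≤ _ := by gcongr
  · rw [select, if_neg h]
    obtain ⟨-, -, -, hsub⟩ := I.fill_spec L (by simp [hL]) fun x hx => by
      obtain ⟨i, rfl⟩ := (List.mem_ofFn' _ _).1 hx
      exact (C i).2
    rw [configVal, Finset.mul_sum]
    refine Finset.sum_le_sum fun x _ => ?_
    obtain ⟨i, hi⟩ := exists_configDist_eq I.one_le I.capped x C
    have hne : ∃ j, I.M.num x (C j) < I.cap := by
      by_contra! hne
      refine h ?_
      simp only [List.any_eq_true, List.all_eq_true, List.mem_range, decide_eq_true_eq]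
      refine ⟨x, x.2, fun a ha => ?_⟩
      obtain ⟨j, rfl⟩ := (List.mem_ofFn' _ _).1 ha
      rw [RationalMetric.numN_fin]
      exact hne j
    obtain ⟨j, hj⟩ := hne
    have hij : I.M.num x (C i) ≤ I.cap := by
      have h1 := configDist_le I.capped x C j
      rw [hi, capped_dist, capped_dist, div_le_div_iff_of_pos_right hcap] at h1
      have h2 : min (I.M.num x (C i)) I.cap ≤ min (I.M.num x (C j)) I.cap := by exact_mod_cast h1
      omega
    refine (I.iInf_points_le x (C i) (hsub (by rw [hL]; simp))).trans_eq ?_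
    rw [hi, capped_dist, min_eq_left (by exact_mod_cast hij)]
    field_simp

/-- Cutting off only decreases distances. This gives the comparison with the optimum. -/
theorem configVal_capped_le (C : Fin I.k → Fin I.n) (A : Finset (Fin I.n))
    (hA : ∀ a ∈ A, a ∈ Set.range C) (hne : A.Nonempty) :
    I.cap / I.M.den * configVal I.capped C ≤ medianVal I.M A := by
  have hcap := I.cap_pos'
  have hden := I.den_pos'
  have : Nonempty A := hne.to_subtype
  rw [configVal, Finset.mul_sum]
  refine Finset.sum_le_sum fun x _ => le_ciInf fun a => ?_
  obtain ⟨i, hi⟩ := hA a a.2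
  have h1 := configDist_le I.capped x C i
  calc _ ≤ I.cap / I.M.den * I.capped.dist x (C i) := by gcongr
    _ ≤ I.cap / I.M.den * (I.M.num x (C i) / I.cap) := by
      rw [capped_dist]
      gcongr
      exact min_le_left _ _
    _ = I.M.dist x a := by
      rw [hi, RationalMetric.dist]
      field_simp

/-- A single point at distance at least half the radius suffices: `cap` is at most `2 * n` times the
radius, hence at most `4 * n` times that distance. -/
theorem one_le_configVal_capped (h : 0 < I.radius) (C : Fin I.k → Fin I.n) :
    1 ≤ 4 * I.n * configVal I.capped C := by
  have hcap := I.cap_pos'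
  obtain ⟨x, hx⟩ := I.exists_far_point C
  obtain ⟨i, hi⟩ := exists_configDist_eq I.one_le I.capped x C
  have h1 : configDist I.capped x C ≤ configVal I.capped C :=
    Finset.single_le_sum (f := fun x => configDist I.capped x C)
      (fun _ _ => configDist_nonneg _ _ _) (Finset.mem_univ x)
  have h2 := hx i
  have h3 := I.cap_le h
  have h4 := I.radius_mul_le_cap
  have hn := I.n_pos
  have h5 : I.cap ≤ 4 * I.n * min (I.M.num x (C i)) I.cap := by
    rcases le_total (I.M.num x (C i)) I.cap with h6 | h6
    · rw [min_eq_left h6]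
      nlinarith
    · rw [min_eq_right h6]
      nlinarith
  have h6 : (I.cap : ℝ) ≤ 4 * I.n * min (I.M.num x (C i) : ℝ) I.cap := by exact_mod_cast h5
  calc (1 : ℝ) = I.cap / I.cap := (div_self hcap.ne').symm
    _ ≤ 4 * I.n * min (I.M.num x (C i) : ℝ) I.cap / I.cap := by gcongr
    _ = 4 * I.n * configDist I.capped x C := by rw [hi, capped_dist]; ring
    _ ≤ _ := by gcongr

end Inst

/-! ### Averages over strings of random bits -/

/-- The average of `g` over all strings of `m` bits. -/
def avg : ℕ → (List Bool → ℝ) → ℝ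
  | 0, g => g []
  | m + 1, g => (avg m (fun l => g (false :: l)) + avg m fun l => g (true :: l)) / 2

/-- Disjoint segments of the random string are independent. All uses of independence go through this
splitting, for which lists are more convenient than functions on `Fin m`. -/
theorem avg_add_length (a b : ℕ) (g : List Bool → ℝ) :
    avg (a + b) g = avg a fun u => avg b fun v => g (u ++ v) := by
  induction a generalizing g with
  | zero => simp [avg]
  | succ a ih => rw [Nat.add_right_comm, avg, avg, ih, ih]; rfl

theorem avg_mono {m : ℕ} {g h : List Bool → ℝ} (H : ∀ l, l.length = m → g l ≤ h l) :
    avg m g ≤ avg m h := by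
  induction m generalizing g h with
  | zero => exact H [] rfl
  | succ m ih =>
    have h1 := ih (g := fun l => g (false :: l)) (h := fun l => h (false :: l))
      fun l hl => H _ (by simp [hl])
    have h2 := ih (g := fun l => g (true :: l)) (h := fun l => h (true :: l))
      fun l hl => H _ (by simp [hl])
    rw [avg, avg]
    linarith

theorem avg_congr {m : ℕ} {g h : List Bool → ℝ} (H : ∀ l, l.length = m → g l = h l) :
    avg m g = avg m h :=
  le_antisymm (avg_mono fun l hl => (H l hl).le) (avg_mono fun l hl => (H l hl).ge)

theorem avg_const (m : ℕ) (x : ℝ) : (avg m fun _ => x) = x := by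
  induction m with
  | zero => rfl
  | succ m ih => rw [avg, ih]; ring

theorem avg_add (m : ℕ) (g h : List Bool → ℝ) :
    (avg m fun l => g l + h l) = avg m g + avg m h := by
  induction m generalizing g h with
  | zero => rfl
  | succ m ih => rw [avg, avg, avg, ih, ih]; ring

theorem avg_mul (m : ℕ) (x : ℝ) (g : List Bool → ℝ) : (avg m fun l => x * g l) = x * avg m g := by
  induction m generalizing g with
  | zero => rfl
  | succ m ih => rw [avg, avg, ih, ih]; ring

theorem avg_sum {ι : Type} (s : Finset ι) (m : ℕ) (g : ι → List Bool → ℝ) :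
    (avg m fun l => ∑ i ∈ s, g i l) = ∑ i ∈ s, avg m (g i) := by
  induction m generalizing g with
  | zero => rfl
  | succ m ih => simp only [avg, ih]; rw [← Finset.sum_add_distrib, Finset.sum_div]

theorem avg_nonneg {m : ℕ} {g : List Bool → ℝ} (H : ∀ l, 0 ≤ g l) : 0 ≤ avg m g := by
  rw [← avg_const m 0]
  exact avg_mono fun l _ => H l

theorem expect_ofFn (m : ℕ) (g : List Bool → ℝ) :
    expect (fun r : Fin m → Bool => g (List.ofFn r)) = avg m g := by
  induction m generalizing g with
  | zero => simp [expect, avg]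
  | succ m ih =>
    rw [avg, ← ih, ← ih, expect, expect, expect,
      ← (Fin.consEquiv fun _ : Fin (m + 1) => Bool).sum_comp, Fintype.sum_prod_type]
    simp only [Fin.consEquiv_apply, List.ofFn_succ, Fin.cons_zero, Fin.cons_succ, Fintype.sum_bool]
    rw [pow_succ]
    field_simp
    ring

theorem expect_eq_avg (m : ℕ) (g : (Fin m → Bool) → ℝ) :
    expect g = avg m fun l => g fun i => l.getD i false := by
  rw [← expect_ofFn]
  congr 1
  funext r
  congr 1
  funext i
  rw [List.getD_eq_getElem _ _ (by simp)]
  simp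

/-! #### The distribution of a sample -/

/-- Horner's scheme modulo `N`: reading `L` more bits after the value `v` leads to each number from
`v * 2 ^ L` to `v * 2 ^ L + 2 ^ L - 1` exactly once. -/
theorem avg_sample (N L v : ℕ) (g : ℕ → ℝ) :
    (avg L fun l => g (l.foldl (fun v b => (2 * v + b.toNat) % N) (v % N))) =
      (∑ j ∈ Finset.range (2 ^ L), g ((v * 2 ^ L + j) % N)) / 2 ^ L := by
  induction L generalizing v with
  | zero => simp [avg]
  | succ L ih =>
    have h : ∀ b : Bool, (2 * (v % N) + b.toNat) % N = (2 * v + b.toNat) % N := fun b => by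
      rw [Nat.add_mod, Nat.mul_mod, Nat.mod_mod, ← Nat.mul_mod, ← Nat.add_mod]
    simp only [avg, List.foldl_cons, h]
    rw [ih, ih, pow_succ, mul_two, Finset.sum_range_add, pow_succ]
    have h1 : ∀ j, (2 * v + Bool.false.toNat) * 2 ^ L + j = v * (2 ^ L + 2 ^ L) + j := fun j => by
      simp only [Bool.toNat_false]; ring
    have h2 : ∀ j, (2 * v + Bool.true.toNat) * 2 ^ L + j = v * (2 ^ L + 2 ^ L) + (2 ^ L + j) :=
      fun j => by simp only [Bool.toNat_true]; ring
    simp only [h1, h2]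
    field_simp

theorem sum_range_mul_mod (N q : ℕ) (g : ℕ → ℝ) :
    ∑ j ∈ Finset.range (q * N), g (j % N) = q * ∑ x ∈ Finset.range N, g x := by
  induction q with
  | zero => simp
  | succ q ih =>
    rw [Nat.succ_mul, Finset.sum_range_add, ih]
    have : ∑ x ∈ Finset.range N, g ((q * N + x) % N) = ∑ x ∈ Finset.range N, g x :=
      Finset.sum_congr rfl fun x hx => by
        rw [mul_comm, Nat.mul_add_mod, Nat.mod_eq_of_lt (Finset.mem_range.1 hx)]
    rw [this]
    push_cast
    ring

/-- A sample is nearly uniformly distributed. -/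
theorem avg_sample_bounds {N m c : ℕ} (hN : 0 < N) (hm : N ≤ 2 ^ m) (g : ℕ → ℝ)
    (hg : ∀ x, 0 ≤ g x) :
    (1 - 1 / 2 ^ c) / N * ∑ x ∈ Finset.range N, g x ≤ (avg (m + c) fun l => g (sample N l)) ∧
    (avg (m + c) fun l => g (sample N l)) ≤ (1 + 1 / 2 ^ c) / N * ∑ x ∈ Finset.range N, g x := by
  have h := avg_sample N (m + c) 0 g
  simp only [Nat.zero_mod, zero_mul, zero_add] at h
  have h' : (avg (m + c) fun l => g (sample N l)) =
      (∑ j ∈ Finset.range (2 ^ (m + c)), g (j % N)) / 2 ^ (m + c) := h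
  rw [h']
  set P : ℕ := 2 ^ (m + c) with hP
  set G := ∑ x ∈ Finset.range N, g x with hG
  have hG0 : 0 ≤ G := Finset.sum_nonneg fun x _ => hg x
  have hP' : ((2 : ℝ) ^ (m + c)) = P := by rw [hP]; push_cast; rfl
  have hPpos : (0 : ℝ) < P := by rw [← hP']; positivity
  have hNpos : (0 : ℝ) < N := by exact_mod_cast hN
  have hsplit : ∑ j ∈ Finset.range P, g (j % N) =
      (P / N : ℕ) * G + ∑ x ∈ Finset.range (P % N), g x := by
    conv_lhs => rw [← Nat.div_add_mod' P N]
    rw [Finset.sum_range_add, sum_range_mul_mod]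
    congr 1
    refine Finset.sum_congr rfl fun x hx => ?_
    have h1 := Finset.mem_range.1 hx
    have h2 := Nat.mod_lt P hN
    rw [mul_comm, Nat.mul_add_mod, Nat.mod_eq_of_lt (by omega)]
  have hrem0 : 0 ≤ ∑ x ∈ Finset.range (P % N), g x := Finset.sum_nonneg fun x _ => hg x
  have hrem1 : ∑ x ∈ Finset.range (P % N), g x ≤ G :=
    Finset.sum_le_sum_of_subset_of_nonneg
      (Finset.range_subset_range.2 (Nat.mod_lt P hN).le) fun x _ _ => hg x
  have hq1 : (P / N : ℕ) ≤ (P : ℝ) / N := Nat.cast_div_le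
  have hq2 : (P : ℝ) / N - 1 ≤ (P / N : ℕ) := by
    have h1 := Nat.lt_div_mul_add (a := P) hN
    have h2 : (P : ℝ) < (P / N : ℕ) * N + N := by exact_mod_cast h1
    rw [sub_le_iff_le_add, div_le_iff₀ hNpos]
    linarith
  -- Each residue occurs `P / N` times up to an error of at most one. The `c` surplus bits make this
  -- one a fraction `2 ^ (-c)` of `P / N`.
  have hδ : (1 : ℝ) ≤ P / N * (1 / 2 ^ c) := by
    rw [← hP', pow_add]
    have h1 : (N : ℝ) ≤ 2 ^ m := by exact_mod_cast hm
    have h2 : (0 : ℝ) < 2 ^ c := by positivity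
    rw [show (2 : ℝ) ^ m * 2 ^ c / N * (1 / 2 ^ c) = 2 ^ m / N by field_simp, le_div_iff₀ hNpos]
    linarith
  rw [hP', hsplit, le_div_iff₀ hPpos, div_le_iff₀ hPpos]
  constructor
  · calc (1 - 1 / 2 ^ c) / N * G * P = (P / N - P / N * (1 / 2 ^ c)) * G := by ring
      _ ≤ (P / N : ℕ) * G := by gcongr; linarith
      _ ≤ _ := by linarith
  · calc (P / N : ℕ) * G + ∑ x ∈ Finset.range (P % N), g x ≤ (P / N : ℕ) * G + 1 * G := by linarith
      _ ≤ P / N * G + P / N * (1 / 2 ^ c) * G := by gcongr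
      _ = _ := by ring

theorem avg_sample_fin_bounds {N m c : ℕ} (hN : 0 < N) (hm : N ≤ 2 ^ m) (g : Fin N → ℝ)
    (hg : ∀ x, 0 ≤ g x) :
    (1 - 1 / 2 ^ c) / N * ∑ x, g x ≤ (avg (m + c) fun l => g ⟨sample N l, sample_lt hN l⟩) ∧
    (avg (m + c) fun l => g ⟨sample N l, sample_lt hN l⟩) ≤ (1 + 1 / 2 ^ c) / N * ∑ x, g x := by
  have := avg_sample_bounds (c := c) hN hm (fun x => if h : x < N then g ⟨x, h⟩ else 0) fun x => by
    split_ifs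
    · exact hg _
    · exact le_rfl
  simp only [sample_lt hN, dif_pos] at this
  rw [Finset.sum_range] at this
  simpa using this

/-! #### The run of the online algorithm on random requests -/

theorem segment_append_left {u v : List Bool} {i L : ℕ} (h : i + L ≤ u.length) :
    segment (u ++ v) i L = segment u i L := by
  refine List.map_congr_left fun j hj => ?_
  have hj := List.mem_range.1 hj
  rw [List.getD_append _ _ _ _ (by omega)]

theorem segment_append_right (u v : List Bool) (i L : ℕ) :
    segment (u ++ v) (u.length + i) L = segment v i L := by
  rw [← segment_drop, List.drop_left]

theorem segment_self (u : List Bool) : segment u 0 u.length = u := by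
  refine List.ext_getElem (by simp [segment]) fun i h1 h2 => ?_
  simp [segment, List.getElem?_eq_getElem h2]

namespace Inst

variable (p : Polynomial ℕ) (c : ℕ) (I : Inst)

theorem request_append_left {u : List Bool} (v : List Bool) {t m : ℕ}
    (hu : u.length = m * I.requestCoins c) (ht : t < m) :
    I.request c (u ++ v) t = I.request c u t := by
  have h : t * I.requestCoins c + I.requestCoins c ≤ u.length := by
    rw [hu, ← Nat.succ_mul]
    exact Nat.mul_le_mul_right _ ht
  simp only [request, segment_append_left h]

theorem request_append_middle {u v : List Bool} (w : List Bool) {t : ℕ}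
    (hu : u.length = t * I.requestCoins c) (hv : v.length = I.requestCoins c) :
    I.request c (u ++ (v ++ w)) t = ⟨sample I.n v, sample_lt I.n_pos v⟩ := by
  have h : segment (u ++ (v ++ w)) (t * I.requestCoins c) (I.requestCoins c) = v := by
    rw [← hu]
    conv_lhs => rw [← Nat.add_zero u.length]
    rw [segment_append_right, ← hv, segment_append_left (by simp), segment_self]
  simp only [request, h]

/-- The answer in round `t` reads only the request bits of the rounds up to `t`; this makes it
independent of the next request. -/
theorem answer_append (A : KServerAlgorithm) (w : List Bool) {u : List Bool} (v : List Bool)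
    {t m : ℕ} (hu : u.length = m * I.requestCoins c) (ht : t < m) :
    A.answer p c I w (u ++ v) t = A.answer p c I w u t := by
  simp only [KServerAlgorithm.answer, KServerAlgorithm.configAt]
  congr 1
  refine List.map_congr_left fun s hs => ?_
  have hs := List.mem_range.1 hs
  exact I.request_append_left c v hu (by omega)

/-- The requests are nearly uniformly distributed, and independent of the past. -/
theorem avg_request {T t : ℕ} (ht : t < T) (g : List Bool → Fin I.n → ℝ) (hg : ∀ v x, 0 ≤ g v x)
    (hind : ∀ u v, u.length = t * I.requestCoins c → g (u ++ v) = g u) :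
    (1 - 1 / 2 ^ c) / I.n * (avg (T * I.requestCoins c) fun v => ∑ x, g v x) ≤
      (avg (T * I.requestCoins c) fun v => g v (I.request c v t)) ∧
    (avg (T * I.requestCoins c) fun v => g v (I.request c v t)) ≤
      (1 + 1 / 2 ^ c) / I.n * (avg (T * I.requestCoins c) fun v => ∑ x, g v x) := by
  -- The bits are split into those of the rounds before `t`, of round `t`, and of the rounds after
  -- it.
  obtain ⟨s, rfl⟩ : ∃ s, T = t + (1 + s) := ⟨T - t - 1, by omega⟩
  rw [add_mul, add_mul, one_mul, avg_add_length, avg_add_length]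
  simp only [avg_add_length (I.requestCoins c)]
  have h1 : (avg (t * I.requestCoins c) fun u => avg (I.requestCoins c) fun v =>
      avg (s * I.requestCoins c) fun w => g (u ++ (v ++ w)) (I.request c (u ++ (v ++ w)) t)) =
      avg (t * I.requestCoins c) fun u => avg (I.requestCoins c) fun v =>
        g u ⟨sample I.n v, sample_lt I.n_pos v⟩ := by
    refine avg_congr fun u hu => avg_congr fun v hv => ?_
    simp only [hind u _ hu, I.request_append_middle c _ hu hv, avg_const]
  have h2 : (avg (t * I.requestCoins c) fun u => avg (I.requestCoins c) fun v =>
      avg (s * I.requestCoins c) fun w => ∑ x, g (u ++ (v ++ w)) x) =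
      avg (t * I.requestCoins c) fun u => ∑ x, g u x := by
    refine avg_congr fun u hu => ?_
    simp only [hind u _ hu, avg_const]
  rw [h1, h2, ← avg_mul, ← avg_mul]
  have h3 := fun u => avg_sample_fin_bounds (c := c) I.n_pos I.n.lt_two_pow_self.le (g u) (hg u)
  exact ⟨avg_mono fun u _ => (h3 u).1, avg_mono fun u _ => (h3 u).2⟩

/-- The average cost of the configurations of the online algorithm. -/
theorem sum_avg_configVal_le (A : KServerAlgorithm) {R : ℝ}
    (hR : ∀ x : ℕ → Fin I.n, expect (fun r => serverCost I.capped (I.rounds p + 1) x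
      (A.configAt I.capped I.k (I.rounds p + 1) r x)) ≤
        bestStaticCost I.capped I.k (I.rounds p + 1) x + R) (C : Fin I.k → Fin I.n) :
    (1 - 1 / 2 ^ c) / I.n * ∑ t ∈ Finset.range (I.rounds p),
      (avg ((I.rounds p + 1) * I.requestCoins c) fun v => avg (A.serverCoins p I) fun w =>
        configVal I.capped (A.answer p c I w v t)) ≤
      (I.rounds p + 1) * (2 * ((1 + 1 / 2 ^ c) / I.n * configVal I.capped C)) + R := by
  set S := I.rounds p with hS
  set V := (S + 1) * I.requestCoins c with hV
  set K := A.serverCoins p I with hK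
  have h1 : ∀ v : List Bool, ∑ t ∈ Finset.range S, (avg K fun w =>
      configDist I.capped (I.request c v (t + 1)) (A.answer p c I w v t)) ≤
      ∑ t ∈ Finset.range (S + 1), 2 * configDist I.capped (I.request c v t) C + R := by
    intro v
    have h2 := hR (I.request c v)
    rw [expect_eq_avg] at h2
    have h3 := bestStaticCost_le I.capped (S + 1) (I.request c v) C
    rw [← avg_sum]
    refine (avg_mono fun w _ => ?_).trans (h2.trans (by linarith))
    exact sum_configDist_le_serverCost I.one_le I.capped S (I.request c v)
      (fun t => A.answer p c I w v t)
  have h2 := avg_mono (m := V) fun v _ => h1 v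
  rw [avg_add, avg_const, avg_sum, avg_sum] at h2
  have h3 : ∑ t ∈ Finset.range (S + 1), (avg V fun v =>
      2 * configDist I.capped (I.request c v t) C) ≤
      (S + 1) * (2 * ((1 + 1 / 2 ^ c) / I.n * configVal I.capped C)) := by
    refine (Finset.sum_le_card_nsmul _ _ (2 * ((1 + 1 / 2 ^ c) / I.n * configVal I.capped C))
      fun t ht => ?_).trans_eq ?_
    · rw [avg_mul]
      have h4 := (I.avg_request c (Finset.mem_range.1 ht) (fun _ x => configDist I.capped x C)
        (fun _ _ => configDist_nonneg _ _ _) fun _ _ _ => rfl).2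
      rw [avg_const] at h4
      exact mul_le_mul_of_nonneg_left h4 zero_le_two
    · rw [Finset.card_range, nsmul_eq_mul]
      push_cast
      rfl
  refine le_trans ?_ (h2.trans (add_le_add_left h3 R))
  rw [Finset.mul_sum]
  refine Finset.sum_le_sum fun t ht => ?_
  have ht := Finset.mem_range.1 ht
  -- Request `t + 1` meets the configuration of round `t`. The horizon is `S + 1` so that this
  -- request exists for all `t < S`.
  have h4 := (I.avg_request c (T := S + 1) (t := t + 1) (by omega) (fun v x => avg K fun w =>
    configDist I.capped x (A.answer p c I w v t))
    (fun _ _ => avg_nonneg fun _ => configDist_nonneg _ _ _) fun u v hu => by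
      funext x
      refine avg_congr fun w _ => ?_
      rw [I.answer_append p c A w v hu (by omega)]).1
  simp only [← avg_sum] at h4
  exact h4

/-- The average cost of the configuration in a random round. -/
theorem avg_configVal_le (A : KServerAlgorithm) {R : ℝ}
    (hR : ∀ x : ℕ → Fin I.n, expect (fun r => serverCost I.capped (I.rounds p + 1) x
      (A.configAt I.capped I.k (I.rounds p + 1) r x)) ≤
        bestStaticCost I.capped I.k (I.rounds p + 1) x + R) (C : Fin I.k → Fin I.n) :
    (1 - 1 / 2 ^ c) * (avg (I.stopCoins p c) fun u =>
      avg ((I.rounds p + 1) * I.requestCoins c) fun v => avg (A.serverCoins p I) fun w =>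
        configVal I.capped (A.answer p c I w v (I.stopRound p c u))) ≤
      (1 + 1 / 2 ^ c) / I.rounds p * ((I.rounds p + 1) * (2 * ((1 + 1 / 2 ^ c) *
        configVal I.capped C)) + I.n * R) := by
  have h1 := I.sum_avg_configVal_le p c A hR C
  set Q : ℕ → ℝ := fun t => avg ((I.rounds p + 1) * I.requestCoins c) fun v =>
    avg (A.serverCoins p I) fun w => configVal I.capped (A.answer p c I w v t) with hQ
  have hS : 0 < I.rounds p := Nat.succ_pos _
  have hn : (0 : ℝ) < I.n := by exact_mod_cast I.n_pos
  have hQ0 : ∀ t, 0 ≤ Q t := fun t => avg_nonneg fun v => avg_nonneg fun w =>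
    Finset.sum_nonneg fun _ _ => configDist_nonneg _ _ _
  have h2 := (avg_sample_bounds (c := c) hS (I.rounds p).lt_two_pow_self.le Q hQ0).2
  have h3 : (avg (I.stopCoins p c) fun u => Q (I.stopRound p c u)) =
      avg (I.rounds p + c) fun u => Q (sample (I.rounds p) u) := by
    refine avg_congr fun u hu => ?_
    rw [stopRound, ← hu, segment_self]
  have hδ : (0 : ℝ) ≤ 1 - 1 / 2 ^ c := by
    rw [sub_nonneg, div_le_one (by positivity)]
    exact one_le_pow₀ one_le_two
  have h4 := mul_le_mul_of_nonneg_left h2 hδ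
  rw [h3]
  refine h4.trans ?_
  have h5 := mul_le_mul_of_nonneg_left h1 hn.le
  calc (1 - 1 / 2 ^ c) * ((1 + 1 / 2 ^ c) / (I.rounds p) * ∑ x ∈ Finset.range (I.rounds p), Q x)
      = (1 + 1 / 2 ^ c) / (I.rounds p) * (I.n * ((1 - 1 / 2 ^ c) / I.n *
        ∑ t ∈ Finset.range (I.rounds p), Q t)) := by field_simp
    _ ≤ (1 + 1 / 2 ^ c) / (I.rounds p) * (I.n * ((I.rounds p + 1) * (2 * ((1 + 1 / 2 ^ c) / I.n *
        configVal I.capped C)) + R)) := by gcongr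
    _ = _ := by field_simp

end Inst

/-! ### The approximation algorithm -/

theorem Inst.exists_list_fin (I : Inst) {l : List ℕ} (hl : l.Nodup) (hlt : ∀ x ∈ l, x < I.n) :
    ∃ l' : List (Fin I.n), l'.Nodup ∧ l'.toFinset = I.points l ∧
      l'.map (fun i : Fin I.n => (i : ℕ)) = l := by
  obtain ⟨l', rfl⟩ : ∃ l' : List (Fin I.n), l'.map (fun i : Fin I.n => (i : ℕ)) = l := by
    clear hl
    induction l with
    | nil => exact ⟨[], rfl⟩
    | cons x l ih =>
      obtain ⟨l', rfl⟩ := ih fun y hy => hlt y (List.mem_cons_of_mem _ hy)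
      exact ⟨⟨x, hlt x List.mem_cons_self⟩ :: l', rfl⟩
  refine ⟨l', hl.of_map, ?_, rfl⟩
  ext x
  simp [Inst.points, Fin.val_inj]

theorem Inst.centres_spec (A : KServerAlgorithm) (p : Polynomial ℕ) (c : ℕ) (I : Inst)
    (l : List Bool) : (A.centres p c I l).Nodup ∧ (A.centres p c I l).length = I.k ∧
      ∀ x ∈ A.centres p c I l, x < I.n := by
  have : ∀ C : List ℕ, C.length ≤ I.k → (∀ x ∈ C, x < I.n) →
      (I.fill (I.select C)).Nodup ∧ (I.fill (I.select C)).length = I.k ∧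
        ∀ x ∈ I.fill (I.select C), x < I.n := by
    intro C hC hlt
    have h : (I.select C).length ≤ I.k ∧ ∀ x ∈ I.select C, x < I.n := by
      rw [Inst.select]
      split_ifs
      · exact ⟨I.length_greedy.le, fun x hx => I.greedy_lt hx⟩
      · exact ⟨hC, hlt⟩
    obtain ⟨h1, h2, h3, -⟩ := I.fill_spec _ h.1 h.2
    exact ⟨h1, h2, h3⟩
  refine this _ (by simp) fun x hx => ?_
  obtain ⟨i, rfl⟩ := (List.mem_ofFn' _ _).1 hx
  exact Fin.is_lt _

theorem Inst.card_points_centres (A : KServerAlgorithm) (p : Polynomial ℕ) (c : ℕ) (I : Inst)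
    (l : List Bool) : (I.points (A.centres p c I l)).card = I.k := by
  obtain ⟨h1, h2, h3⟩ := I.centres_spec A p c l
  obtain ⟨l', h4, h5, h6⟩ := I.exists_list_fin h1 h3
  rw [← h5, List.toFinset_card_of_nodup h4, ← h2, ← h6, List.length_map]

/-- The number of random bits that are used is polynomial in the size of the instance. -/
theorem polyBounded_coins (A : KServerAlgorithm) (p : Polynomial ℕ) (c : ℕ) :
    PolyBounded (fun I : Inst => I.M.inputSize I.k) fun I =>
      I.stopCoins p c + ((I.rounds p + 1) * I.requestCoins c + A.serverCoins p I) := by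
  have hI := PT.refl Inst.enc
  have hn := PT.inst_n (I := fun I => I) hI
  have hS : PT Inst.enc fun I => .ofUnary (I.rounds p) := PT.succ (PT.polynomial hn p)
  have hL : PT Inst.enc fun I => .ofUnary (I.requestCoins c) := PT.add hn (PT.const (.ofUnary c))
  have hL' : PT Inst.enc fun I => .ofUnary (I.stopCoins p c) := PT.add hS (PT.const (.ofUnary c))
  have hA : PT Inst.enc fun I => .ofUnary (A.serverCoins p I) :=
    PT.polynomial (PT.add (PT.inputSize (PT.capped (I := fun I => I) hI)) (PT.succ hS)) A.coins
  exact PT.unary_le (PT.add hL' (PT.add (PT.mul (PT.succ hS) hL) hA))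

open Classical in
/-- The set of centres that is found with the random bits `r`. -/
def KServerAlgorithm.solution (A : KServerAlgorithm) (p : Polynomial ℕ) (c : ℕ) {n : ℕ}
    (M : RationalMetric n) (k : ℕ) (l : List Bool) : Finset (Fin n) :=
  if h : 1 ≤ k ∧ k ≤ n then
    (⟨n, k, M, h.1, h.2⟩ : Inst).points (A.centres p c ⟨n, k, M, h.1, h.2⟩ l)
  else ∅

/-- The number of bits provided is only a polynomial upper bound for the number needed, since the
latter depends on the size of the capped instance; surplus bits are ignored. -/
theorem exists_kMedianAlgorithm (A : KServerAlgorithm) (p : Polynomial ℕ) (c : ℕ) :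
    ∃ B : KMedianAlgorithm,
      (∀ I : Inst, I.stopCoins p c + ((I.rounds p + 1) * I.requestCoins c + A.serverCoins p I) ≤
        B.coins.eval (I.M.inputSize I.k)) ∧
      ∀ {n : ℕ} (M : RationalMetric n) (k : ℕ) (r : Fin (B.coins.eval (M.inputSize k)) → Bool),
        B.sol M k r = A.solution p c M k (List.ofFn r) := by
  obtain ⟨q, hq⟩ := polyBounded_coins A p c
  have hin : PT (fun x : Inst × List Bool =>
      Data.ofList [x.1.enc, Data.list Data.ofBool x.2])
      (Data.prod Inst.enc (Data.list Data.ofBool)) :=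
    (PT.refl _).fst.pair (PT.refl _).snd.fst
  obtain ⟨P, t, ⟨q', hq'⟩, hP⟩ := hin.trans (PT.centres A p c)
  -- Every random bit contributes at most 4 to the size of the input, and the list structure another
  -- 4.
  refine ⟨⟨P, q, q'.comp (Polynomial.X + Polynomial.C 4 * q + Polynomial.C 4),
    fun M k r => A.solution p c M k (List.ofFn r), ?_⟩, hq, fun _ _ _ => rfl⟩
  intro n M k hk hkn r
  set I : Inst := ⟨n, k, M, hk, hkn⟩ with hIdef
  have hsol : A.solution p c M k (List.ofFn r) = I.points (A.centres p c I (List.ofFn r)) := by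
    rw [KServerAlgorithm.solution, dif_pos ⟨hk, hkn⟩]
  rw [hsol]
  obtain ⟨h1, h2, h3⟩ := I.centres_spec A p c (List.ofFn r)
  obtain ⟨l, h4, h5, h6⟩ := I.exists_list_fin h1 h3
  refine ⟨I.card_points_centres A p c _, l, h4, h5, ?_⟩
  obtain ⟨u, hu, hx⟩ := hP (I, List.ofFn r)
  have hbits : Data.ofBits r = Data.list Data.ofBool (List.ofFn r) := by
    rw [Data.ofBits, Data.list, List.map_ofFn]
    rfl
  refine ⟨initStore (.ofPoints l), u, ?_, ?_, by simp [initStore]⟩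
  · have hout : Data.ofPoints l = Data.list Data.ofUnary (A.centres p c I (List.ofFn r)) := by
      rw [Data.ofPoints_eq, ← h6, Data.list, Data.list, List.map_map]
      rfl
    rw [hbits, hout]
    exact hx
  · refine (hu.trans (hq' _)).trans ?_
    rw [Polynomial.eval_comp]
    refine eval_mono q' ?_
    have hs := Data.size_ofList_le (l := (List.ofFn r).map Data.ofBool) (B := 3) (by
      intro d hd
      obtain ⟨b, -, rfl⟩ := List.mem_map.1 hd
      exact Data.size_ofBool_le b)
    have hsz : I.enc.size = M.inputSize k := rfl
    simp only [List.length_map, List.length_ofFn] at hs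
    simp only [Data.ofList, Data.size, Polynomial.eval_add, Polynomial.eval_mul,
      Polynomial.eval_X, Polynomial.eval_C, hsz, Data.list]
    omega

/-! ### The approximation ratio -/

theorem medianVal_eq_zero {n : ℕ} (M : RationalMetric n) : medianVal M Finset.univ = 0 := by
  refine Finset.sum_eq_zero fun x _ => le_antisymm ?_
    (Real.iInf_nonneg fun _ => M.dist_nonneg _ _)
  refine (ciInf_le (f := fun a : (Finset.univ : Finset (Fin n)) => M.dist x a)
    (Set.finite_range _).bddBelow ⟨x, Finset.mem_univ x⟩).trans_eq ?_
  rw [RationalMetric.dist, M.num_self, Nat.cast_zero, zero_div]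

namespace Inst

variable (I : Inst)

/-- The value of an optimal set of centres, in terms of the cut-off metric. -/
theorem exists_configVal_capped_le :
    ∃ C : Fin I.k → Fin I.n, I.cap / I.M.den * configVal I.capped C ≤ medianOpt I.M I.k := by
  obtain ⟨A₀, -, hA₀⟩ := Finset.exists_subset_card_eq
    (s := (Finset.univ : Finset (Fin I.n))) (n := I.k) (by simpa using I.le_n)
  have : Nonempty {A : Finset (Fin I.n) // A.card = I.k} := ⟨⟨A₀, hA₀⟩⟩
  obtain ⟨⟨A, hA⟩, h⟩ := exists_eq_ciInf_of_finite
    (f := fun A : {A : Finset (Fin I.n) // A.card = I.k} => medianVal I.M A.1)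
  refine ⟨A.orderEmbOfFin hA, ?_⟩
  rw [medianOpt, ← h]
  refine I.configVal_capped_le _ A (fun a ha => by rw [Finset.range_orderEmbOfFin]; exact ha) ?_
  rw [← Finset.card_pos, hA]
  exact I.one_le

/-- `medianVal_fill_le` holds for each random string, and the string splits into independent parts
for the stopping round, the requests and the online algorithm; an unused rest is averaged away. -/
theorem avg_medianVal_le (A : KServerAlgorithm) (p : Polynomial ℕ) (c : ℕ) {m : ℕ}
    (hm : I.stopCoins p c + ((I.rounds p + 1) * I.requestCoins c + A.serverCoins p I) ≤ m) :
    (avg m fun l => medianVal I.M (I.points (A.centres p c I l))) ≤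
      I.cap / I.M.den * avg (I.stopCoins p c) fun u =>
        avg ((I.rounds p + 1) * I.requestCoins c) fun v => avg (A.serverCoins p I) fun w =>
          configVal I.capped (A.answer p c I w v (I.stopRound p c u)) := by
  obtain ⟨s, rfl⟩ : ∃ s, m = I.stopCoins p c + ((I.rounds p + 1) * I.requestCoins c +
      (A.serverCoins p I + s)) := ⟨m - (I.stopCoins p c + ((I.rounds p + 1) * I.requestCoins c +
      A.serverCoins p I)), by omega⟩
  refine (avg_mono fun l _ => I.medianVal_fill_le _).trans_eq ?_
  rw [avg_mul, avg_add_length]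
  simp only [avg_add_length ((I.rounds p + 1) * I.requestCoins c),
    avg_add_length (A.serverCoins p I)]
  congr 1
  refine avg_congr fun u hu => avg_congr fun v hv => avg_congr fun w hw => ?_
  have h1 : ∀ z : List Bool, I.stopRound p c (u ++ z) = I.stopRound p c u := fun z => by
    rw [stopRound, stopRound, segment_append_left (by omega)]
  have h2 : ∀ z : List Bool, (u ++ z).drop (I.stopCoins p c) = z := fun z =>
    List.drop_left' hu
  have h3 : ∀ z : List Bool, (u ++ (v ++ z)).drop
      (I.stopCoins p c + (I.rounds p + 1) * I.requestCoins c) = z := fun z => by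
    rw [← List.append_assoc]
    exact List.drop_left' (by rw [List.length_append, hu, hv])
  have h4 : ∀ z y t, A.answer p c I (w ++ z) y t = A.answer p c I w y t := fun z y t => by
    simp only [KServerAlgorithm.answer]
    congr 1
    funext i
    rw [List.getD_append _ _ _ _ (by rw [hw]; exact i.2)]
  have h5 : I.stopRound p c u < I.rounds p + 1 := (I.stopRound_lt p c u).trans (Nat.lt_succ_self _)
  simp only [h1, h2, h3, h4, I.answer_append p c A w _ hv h5, avg_const]

end Inst

/-- Here `x` is the sampling error, `V` the optimal and `E` the achieved capped value, `S` the
number of possible stopping rounds and `Y` is `n` times the regret. Each error costs a factor `1 +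
O(x)`. -/
theorem ratio_bound {x ε V E S Y : ℝ} (hx0 : 0 < x) (hx : x ≤ 1 / 2) (hε : 26 * x ≤ ε) (hV : 0 ≤ V)
    (hS : 0 < S) (hSx : 1 ≤ x * S) (hY : Y ≤ (S + 1) * (x * V / 2))
    (h : (1 - x) * E ≤ (1 + x) / S * ((S + 1) * (2 * ((1 + x) * V)) + Y)) : E ≤ (2 + ε) * V := by
  have hT : (S + 1) / S ≤ 1 + x := by
    rw [div_le_iff₀ hS]
    linarith
  have h1 : (1 + x) / S * ((S + 1) * (2 * ((1 + x) * V)) + Y) ≤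
      (1 + x) * (1 + x) * (2 * (1 + x) + x / 2) * V := by
    calc _ ≤ (1 + x) / S * ((S + 1) * (2 * ((1 + x) * V)) + (S + 1) * (x * V / 2)) := by gcongr
      _ = (1 + x) * ((S + 1) / S) * (2 * (1 + x) + x / 2) * V := by field_simp
      _ ≤ _ := by gcongr
  -- The left side is `2 + 6.5 x + 7 x² + 2.5 x³`, and `(1 - x) * (2 + 26 * x)` dominates it for `0
  -- ≤ x ≤ 1/2`.
  have h2 : (1 + x) * (1 + x) * (2 * (1 + x) + x / 2) ≤ (1 - x) * (2 + ε) := by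
    have h3 : (1 - x) * (2 + 26 * x) ≤ (1 - x) * (2 + ε) :=
      mul_le_mul_of_nonneg_left (by linarith) (by linarith)
    refine le_trans ?_ h3
    nlinarith [mul_nonneg hx0.le (sub_nonneg.2 hx), mul_nonneg (mul_nonneg hx0.le hx0.le)
      (sub_nonneg.2 hx)]
  have h4 : (1 - x) * E ≤ (1 - x) * ((2 + ε) * V) := by
    calc _ ≤ _ := h.trans h1
      _ ≤ (1 - x) * (2 + ε) * V := mul_le_mul_of_nonneg_right h2 hV
      _ = _ := by ring
  exact le_of_mul_le_mul_left h4 (by linarith)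

/-- The polynomial that determines the time horizon. -/
def horizonPoly (f : Polynomial ℕ) (c m : ℕ) : Polynomial ℕ :=
  (Polynomial.C (8 * 2 ^ c) * Polynomial.X ^ 2 * (f + 1)) ^ m

/-- The horizon `T` exceeds the `m`-th power of `b = 8 * 2 ^ c * n ^ 2 * (f n + 1)`, and `m * μ ≥
1`, so `T ^ μ ≥ b`. As `V ≥ 1 / (4 n)`, this makes `n * f n / T ^ μ` at most `V / (2 * 2 ^ c)`; the
8 is the product of this 4 and this 2. -/
theorem regret_bound (f : Polynomial ℕ) {μ : ℝ} (c m : ℕ) (hm : 1 ≤ m * μ) (I : Inst) {V : ℝ}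
    (hV : 1 ≤ 4 * I.n * V) :
    (I.n : ℝ) * (((f.eval I.n : ℕ) : ℝ) *
      ((I.rounds (horizonPoly f c m) + 1 : ℕ) : ℝ) ^ (1 - μ)) ≤
      ((I.rounds (horizonPoly f c m) : ℝ) + 1) * (1 / 2 ^ c * V / 2) := by
  set S := I.rounds (horizonPoly f c m) with hS
  set F : ℝ := ((f.eval I.n : ℕ) : ℝ) with hF
  have hn : (1 : ℝ) ≤ I.n := by exact_mod_cast I.n_pos
  have hF0 : 0 ≤ F := Nat.cast_nonneg _
  set b : ℝ := 8 * 2 ^ c * I.n ^ 2 * (F + 1) with hb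
  have h2c : (1 : ℝ) ≤ 2 ^ c := one_le_pow₀ one_le_two
  have hb1 : 1 ≤ b := by
    have h1 : (1 : ℝ) ≤ I.n ^ 2 := one_le_pow₀ hn
    calc (1 : ℝ) ≤ 8 * 1 * 1 * (0 + 1) := by norm_num
      _ ≤ b := by rw [hb]; gcongr
  have hSb : ((S + 1 : ℕ) : ℝ) = b ^ m + 2 := by
    rw [hS, Inst.rounds, horizonPoly]
    simp only [Polynomial.eval_pow, Polynomial.eval_mul, Polynomial.eval_C, Polynomial.eval_X,
      Polynomial.eval_add, Polynomial.eval_one]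
    push_cast
    ring
  set T : ℝ := ((S + 1 : ℕ) : ℝ) with hT
  have hbm : b ^ m ≤ T := by rw [hSb]; linarith
  have hT0 : 0 < T := by rw [hSb]; positivity
  have hμ : 0 ≤ μ := by
    by_contra h
    have : (m : ℝ) * μ ≤ 0 := mul_nonpos_of_nonneg_of_nonpos (Nat.cast_nonneg _) (not_le.1 h).le
    linarith
  have hTμ : b ≤ T ^ μ := by
    calc b = b ^ (1 : ℝ) := (Real.rpow_one b).symm
      _ ≤ b ^ ((m : ℝ) * μ) := Real.rpow_le_rpow_of_exponent_le hb1 hm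
      _ = (b ^ m) ^ μ := by rw [Real.rpow_mul (by linarith), Real.rpow_natCast]
      _ ≤ T ^ μ := Real.rpow_le_rpow (by positivity) hbm hμ
  have hTμ0 : 0 < T ^ μ := Real.rpow_pos_of_pos hT0 μ
  have hkey : I.n * F ≤ T ^ μ * (1 / 2 ^ c * V / 2) := by
    have hV0 : 0 ≤ V := by
      by_contra h
      have : 4 * (I.n : ℝ) * V ≤ 0 :=
        mul_nonpos_of_nonneg_of_nonpos (by positivity) (not_le.1 h).le
      linarith
    calc (I.n : ℝ) * F ≤ I.n * (F + 1) * 1 := by nlinarith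
      _ ≤ I.n * (F + 1) * (4 * I.n * V) := by gcongr
      _ = b * (1 / 2 ^ c * V / 2) := by rw [hb]; field_simp; ring
      _ ≤ _ := by gcongr
  have hT1 : (S : ℝ) + 1 = T := by rw [hT]; push_cast; rfl
  rw [hT1, Real.rpow_sub hT0, Real.rpow_one]
  calc (I.n : ℝ) * (F * (T / T ^ μ)) = T / T ^ μ * (I.n * F) := by ring
    _ ≤ T / T ^ μ * (T ^ μ * (1 / 2 ^ c * V / 2)) := by gcongr
    _ = _ := by field_simp

theorem Inst.avg_medianVal_le_medianOpt (A : KServerAlgorithm) (f : Polynomial ℕ) {μ ε : ℝ}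
    (hregret : A.HasRegret fun n T => ((f.eval n : ℕ) : ℝ) * (T : ℝ) ^ (1 - μ)) {c m : ℕ}
    (hc : (1 : ℝ) / 2 ^ c ≤ 1 / 2) (hcε : 26 * ((1 : ℝ) / 2 ^ c) ≤ ε) (hm0 : m ≠ 0)
    (hm : 1 ≤ m * μ) (I : Inst) {M : ℕ}
    (hM : I.stopCoins (horizonPoly f c m) c + ((I.rounds (horizonPoly f c m) + 1) *
      I.requestCoins c + A.serverCoins (horizonPoly f c m) I) ≤ M) :
    (avg M fun l => medianVal I.M (I.points (A.centres (horizonPoly f c m) c I l))) ≤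
      (2 + ε) * medianOpt I.M I.k := by
  set p := horizonPoly f c m with hp
  have hε : 0 < ε := lt_of_lt_of_le (by positivity) hcε
  obtain ⟨C, hC⟩ := I.exists_configVal_capped_le
  have hcd : (0 : ℝ) < I.cap / I.M.den := div_pos I.cap_pos' I.den_pos'
  have hV0 : 0 ≤ configVal I.capped C := Finset.sum_nonneg fun _ _ => configDist_nonneg _ _ _
  rcases Nat.eq_zero_or_pos I.radius with hr | hr
  -- The lower bound for the capped value fails for radius zero, but then `k = n` and the output
  -- consists of all points.
  · have huniv : ∀ l, I.points (A.centres p c I l) = Finset.univ := fun l => by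
      rw [← Finset.card_eq_iff_eq_univ, I.card_points_centres, I.k_eq_n hr, Fintype.card_fin]
    have hopt : 0 ≤ medianOpt I.M I.k := (mul_nonneg hcd.le hV0).trans hC
    simp only [huniv, medianVal_eq_zero, avg_const]
    positivity
  · have hV := I.one_le_configVal_capped hr C
    have hR := I.avg_configVal_le p c A
      (hregret I.n I.capped I.k (I.rounds p + 1) I.capped_distLeOne I.one_le I.le_n
        (Nat.le_add_left _ _)) C
    -- This makes the one additional round of the horizon a relative error of at most `2 ^ (-c)`.
    have hS : 2 ^ c ≤ I.rounds p := by
      have h1 : 8 * 2 ^ c * I.n ^ 2 * (f.eval I.n + 1) ≤ p.eval I.n := by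
        rw [hp, horizonPoly]
        simp only [Polynomial.eval_pow, Polynomial.eval_mul, Polynomial.eval_C, Polynomial.eval_X,
          Polynomial.eval_add, Polynomial.eval_one]
        exact Nat.le_self_pow hm0 _
      have h2 : 2 ^ c * 1 ≤ 2 ^ c * (8 * I.n ^ 2 * (f.eval I.n + 1)) := by
        have := Nat.one_le_pow 2 I.n I.n_pos
        refine Nat.mul_le_mul_left _ (Nat.mul_pos ?_ ?_) <;> omega
      have h3 : 2 ^ c * (8 * I.n ^ 2 * (f.eval I.n + 1)) =
        8 * 2 ^ c * I.n ^ 2 * (f.eval I.n + 1) := by ring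
      rw [Inst.rounds]
      omega
    have hS' : (2 : ℝ) ^ c ≤ I.rounds p := by exact_mod_cast hS
    have h2c : (0 : ℝ) < 2 ^ c := by positivity
    have hE := ratio_bound (x := 1 / 2 ^ c) (ε := ε) (by positivity) hc hcε hV0
      (lt_of_lt_of_le h2c hS') (by
        rw [one_div, inv_mul_eq_div, one_le_div h2c]
        exact hS') (regret_bound f c m hm I hV) hR
    calc _ ≤ _ := I.avg_medianVal_le A p c hM
      _ ≤ I.cap / I.M.den * ((2 + ε) * configVal I.capped C) := by gcongr
      _ = (2 + ε) * (I.cap / I.M.den * configVal I.capped C) := by ring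
      _ ≤ _ := by gcongr

end KServer

end

theorem mainTheorem10 (A : KServer.KServerAlgorithm) (f : Polynomial ℕ) (μ : ℝ) (hμ : 0 < μ)
    (hregret : A.HasRegret fun n T => ((f.eval n : ℕ) : ℝ) * (T : ℝ) ^ (1 - μ)) :
    ∀ ε : ℝ, 0 < ε → ∃ B : KServer.KMedianAlgorithm, B.IsApprox (2 + ε) := by
  intro ε hε
  -- The sampling error `2 ^ (-c)` is chosen to meet the two conditions of `ratio_bound`; `m` is an
  -- integer exponent with `m * μ ≥ 1`, so that the horizon is a polynomial.
  obtain ⟨c, hc⟩ := exists_pow_lt_of_lt_one (show (0 : ℝ) < min (1 / 2) (ε / 26) by positivity)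
    (show (1 / 2 : ℝ) < 1 by norm_num)
  rw [one_div_pow] at hc
  obtain ⟨m, hm⟩ := exists_nat_ge (1 / μ)
  rw [div_le_iff₀ hμ] at hm
  have hm0 : m ≠ 0 := by
    rintro rfl
    rw [Nat.cast_zero, zero_mul] at hm
    linarith
  obtain ⟨B, hcoins, hsol⟩ := KServer.exists_kMedianAlgorithm A (KServer.horizonPoly f c m) c
  refine ⟨B, fun n M k hk hkn => ?_⟩
  have h := KServer.Inst.avg_medianVal_le_medianOpt A f (ε := ε) hregret
    (hc.le.trans (min_le_left _ _)) (by
      have := hc.le.trans (min_le_right _ _)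
      linarith) hm0 hm ⟨n, k, M, hk, hkn⟩ (hcoins ⟨n, k, M, hk, hkn⟩)
  rw [← KServer.expect_ofFn] at h
  convert h using 4 with r
  rw [hsol, KServer.KServerAlgorithm.solution, dif_pos ⟨hk, hkn⟩]
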